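/- **Setting.** Let $\mathcal Z$ be a measurable space (e.g. a subset of $\mathbb R^q$) with a measure $\nu$, let $\Theta\subset\mathbb R^p$ be compact and $\theta_0\in\operatorname{interior}(\Theta)$. Let $\Omega\subset\mathbb R^d$ be measurable, $\omega:\Omega\to[0,\infty)$ a weight function and $\varphi:\Omega\times\mathcal Z\times\Theta\to\mathbb R$. The likelihood contributions are $$f(z,\theta)=\int_\Omega\varphi(v,z,\theta)\,\omega(v)\,dv ,$$ and $\{f(\cdot,\theta):\theta\in\Theta\}$ is a family of probability densities with respect to $\nu$. The data $z_1,z_2,\dots$ are i.i.d. with density $f(\cdot,\theta_0)$. For $r\in\mathbb N$ let $U_r(g)=\sum_{j=1}^r w_{j,r}\,g(v_{j,r})$ be a cubature rule with nodes $v_{j,r}\in\Omega$ and real weights $w_{j,r}$, which need not be positive; nodes and weights do not depend on the point $z\in\mathcal Z$ at which $f(z,\theta)$ is approximated, and they may be deterministic or random. Put $\tilde f_r(z,\theta)=U_r(\varphi(\cdot,z,\theta))$ and, for $k=0,1,2$, $$\bar{\mathcal E}_k(r)=\max_{|\alpha|_1\le k}\ \sup_{z\in\mathcal Z,\ \theta\in\Theta}\left|\int_\Omega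 D_\alpha^{(\theta)}\varphi(v,z,\theta)\,\omega(v)\,dv-\sum_{j=1}^r w_{j,r}\,D_\alpha^{(\theta)}\varphi(v_{j,r},z,\theta)\right| .$$ Let $R:\mathbb N\to\mathbb N$ be nondecreasing with $R(n)\to\infty$. The maximum approximated likelihood estimator $\hat\theta_{MAL}=\hat\theta^{(n)}_{MAL}$ is a (measurable) maximizer over $\Theta$ of $$\tilde L_n(\theta)=\frac1n\sum_{i=1}^n\log\tilde f_{R(n)}(z_i,\theta)$$ whenever $\tilde f_{R(n)}(z_i,\theta)>0$ for all $i\le n$ and all $\theta\in\Theta$; otherwise its value is arbitrary. **Statement.** Assume that 1. (identification) for every $\theta\in\Theta$ with $\theta\ne\theta_0$, the functions $f(\cdot,\theta)$ and $f(\cdot,\theta_0)$ are not $\nu$-almost everywhere equal; 2. there is $\bar\delta>0$ with $f(z,\theta)>\bar\delta$ for all $z\in\mathcal Z$, $\theta\in\Theta$; 3. the Fisher information matrix $\mathcal I=\mathbb E\big[\nabla_\theta\log f(z_1,\theta_0)\,(\nabla_\theta\log f(z_1,\theta_0))^T\big]$ is nonsingular; 4. for all $v\in\Omega$ and $z\in\mathcal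 Z$, $\varphi(v,z,\cdot)$ is twice continuously differentiable (in a neighbourhood of each point of $\Theta$); 5. for $|\alpha|_1\le2$, the integrals $\int_\Omega D_\alpha^{(\theta)}\varphi(v,z,\theta)\,\omega(v)\,dv$ exist and are bounded uniformly in $z\in\mathcal Z$, $\theta\in\Theta$; 6. $\bar{\mathcal E}_2(r)\to0$ in probability as $r\to\infty$; 7. $\sqrt n\,\bar{\mathcal E}_1(R(n))\to0$ in probability as $n\to\infty$. Then, as $n\to\infty$, $$\sqrt n\,\big(\hat\theta_{MAL}-\theta_0\big)\ \xrightarrow{\ d\ }\ N\big(0,\mathcal I^{-1}\big).$$ -/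

import Mathlib

open MeasureTheory ProbabilityTheory Filter Topology
open scoped ENNReal

namespace MALE

/-- An `r`-point cubature rule on `ℝ^d`. The weights are arbitrary real numbers; in particular they
may be negative. -/
structure CubatureRule (d r : ℕ) where
  /-- the weights `w_{1,r}, …, w_{r,r}` -/
  weight : Fin r → ℝ
  /-- the nodes `v_{1,r}, …, v_{r,r}` -/
  node : Fin r → EuclideanSpace ℝ (Fin d)

/-- The value `U_r(g) = ∑ j, w_{j,r} g(v_{j,r})` of a cubature rule at an integrand `g`. -/
def CubatureRule.apply {d r : ℕ} (U : CubatureRule d r) (g : EuclideanSpace ℝ (Fin d) → ℝ) : ℝ :=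
  ∑ j, U.weight j * g (U.node j)

/-- The partial derivative `∂^m g / ∂θ_{i 0} ⋯ ∂θ_{i (m-1)}` at `θ`, of order `m`. For a function
of class `C²` and `m ≤ k ≤ 2`, these are exactly the `D_α g` with `|α|₁ ≤ k`, since the
order of differentiation does not matter; for `m = 0` this is `g θ`. -/
noncomputable def partialD {p m : ℕ} (i : Fin m → Fin p) (g : EuclideanSpace ℝ (Fin p) → ℝ)
    (θ : EuclideanSpace ℝ (Fin p)) : ℝ :=
  iteratedFDeriv ℝ m g θ (fun j => EuclideanSpace.single (i j) (1 : ℝ))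

section Likelihood

variable {d p : ℕ} {𝓩 : Type*} (Ω : Set (EuclideanSpace ℝ (Fin d)))
  (ω : EuclideanSpace ℝ (Fin d) → ℝ)
  (φ : EuclideanSpace ℝ (Fin d) → 𝓩 → EuclideanSpace ℝ (Fin p) → ℝ)

/-- The likelihood contribution `f(z, θ) = ∫_Ω φ(v, z, θ) ω(v) dv`. -/
noncomputable def likelihood (z : 𝓩) (θ : EuclideanSpace ℝ (Fin p)) : ℝ :=
  ∫ v in Ω, φ v z θ * ω v

/-- The approximated likelihood contribution `f̃_r(z, θ) = U_r(φ(·, z, θ))`. -/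
def approxLikelihood {r : ℕ} (U : CubatureRule d r) (z : 𝓩) (θ : EuclideanSpace ℝ (Fin p)) : ℝ :=
  U.apply (fun v => φ v z θ)

/-- The approximated log-likelihood `L̃_n(θ) = (1/n) ∑_{i<n} log f̃_r(z_i, θ)` of a
sample `z_0, …, z_{n-1}`. -/
noncomputable def approxLogLikelihood {r : ℕ} (U : CubatureRule d r) (n : ℕ) (z : ℕ → 𝓩)
    (θ : EuclideanSpace ℝ (Fin p)) : ℝ :=
  (n : ℝ)⁻¹ * ∑ i ∈ Finset.range n, Real.log (approxLikelihood φ U (z i) θ)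

/-- The worst-case cubature error of all `θ`-derivatives of `φ` of order at most `k`:
`max_{|α| ≤ k} sup_{z, θ ∈ Θ} |∫_Ω D_α φ(v, z, θ) ω(v) dv - U_r(D_α φ(·, z, θ))|`,
as an element of `[0, ∞]`. -/
noncomputable def cubatureError (Θ : Set (EuclideanSpace ℝ (Fin p))) (k : ℕ) {r : ℕ}
    (U : CubatureRule d r) : ℝ≥0∞ :=
  ⨆ (m : ℕ) (_ : m ≤ k) (i : Fin m → Fin p) (z : 𝓩) (θ : EuclideanSpace ℝ (Fin p)) (_ : θ ∈ Θ),
    ‖(∫ v in Ω, partialD i (φ v z) θ * ω v) - U.apply (fun v => partialD i (φ v z) θ)‖ₑ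

end Likelihood

/-- The Fisher information matrix `𝓘 = E[∇_θ log f(z, θ₀) (∇_θ log f(z, θ₀))ᵀ]`, the expectation
being taken over `z` with law `μ`. -/
noncomputable def fisherInformation {p : ℕ} {𝓩 : Type*} [MeasurableSpace 𝓩] (μ : Measure 𝓩)
    (f : 𝓩 → EuclideanSpace ℝ (Fin p) → ℝ) (θ₀ : EuclideanSpace ℝ (Fin p)) :
    Matrix (Fin p) (Fin p) ℝ :=
  Matrix.of fun i j => ∫ z, gradient (fun θ => Real.log (f z θ)) θ₀ i *
    gradient (fun θ => Real.log (f z θ)) θ₀ j ∂μ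

/-- `X_n → 0` in probability, for nonnegative extended real random quantities `X_n`. (On a set that
is not measurable, `P` is the outer measure.) -/
def TendstoZeroInProbability {S : Type*} [MeasurableSpace S] (P : Measure S) (X : ℕ → S → ℝ≥0∞) :
    Prop :=
  ∀ ε : ℝ≥0∞, 0 < ε → Tendsto (fun n => P {s | ε ≤ X n s}) atTop (𝓝 0)

end MALE

/-!
# Asymptotic normality of the maximum approximated likelihood estimator

The uniform error bound on the cubature of all derivatives of order at most two does more than
control the estimator: since some rules have arbitrarily small error, the likelihood contributions
`f(z, ·)` and their formal derivatives are uniform limits on `Θ` of finite sums of `C²` functions and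
their derivatives. Hence differentiation under the integral sign is justified in the interior of
`Θ` (`hasFDerivAt_derivIntegral`), and `f(z, ·)` together with its derivatives is continuous on
`Θ`. As `f` is bounded and bounded away from zero, the dominating measure is finite, the score is
bounded and centered, and the expected Hessian of `log f` at `θ₀` is `-𝓘`
(`RegularFamily.integral_hess`).

From here on the argument is the classical one. Uniform laws of large numbers come from the strong
law in the separable Banach space of continuous functions on a compact set
(`uniform_law_of_large_numbers`). They give consistency by the information inequality
(`RegularFamily.consistency`) and show that the average score `Sₙ(θ)` equals
`Sₙ(θ₀) - 𝓘 (θ - θ₀)` up to an error `o(|θ - θ₀|)` near `θ₀` (`RegularFamily.score_expansion`).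
The estimator is eventually an interior maximizer, so the gradient of the *approximated*
log-likelihood vanishes there; by the rate assumption on the errors of order at most one, the exact
average score at the estimator is `o_P(n^{-1/2})`. Therefore `T = √n (θ̂ - θ₀)` satisfies
`T = 𝓘⁻¹ √n Sₙ(θ₀) + o_P(1 + |T|)`, and the multivariate central limit theorem, with a version of
Slutsky's theorem for relative errors (`tendstoInDistribution_of_whp_norm_sub_le`), gives the limit.

No measurability of the cubature rules in the random element is assumed, so that statements "with
probability tending to one" refer to outer measure; they are organized by the filter `whp`.
-/

namespace MALE

/-! ### Differentiation under the cubature limit -/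

/-- The linear form on `ℝ^p` with coefficients `c`. The derivative of a function is the linear form
of its partial derivatives. -/
noncomputable def linForm {p : ℕ} (c : Fin p → ℝ) : EuclideanSpace ℝ (Fin p) →L[ℝ] ℝ :=
  ∑ k, c k • EuclideanSpace.proj k

lemma linForm_apply {p : ℕ} (c : Fin p → ℝ) (x : EuclideanSpace ℝ (Fin p)) :
    linForm c x = ∑ k, c k * x k := by
  simp [linForm]

lemma linForm_single {p : ℕ} (c : Fin p → ℝ) (k : Fin p) :
    linForm c (EuclideanSpace.single k 1) = c k := by
  simp [linForm_apply]

lemma norm_le_sum_abs {p : ℕ} (x : EuclideanSpace ℝ (Fin p)) : ‖x‖ ≤ ∑ k, |x k| := by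
  have hx : x = ∑ k, x k • EuclideanSpace.single k (1 : ℝ) := by
    ext j; simp [Pi.single_apply]
  calc ‖x‖ = ‖∑ k, x k • EuclideanSpace.single k (1 : ℝ)‖ := by rw [← hx]
    _ ≤ ∑ k, ‖x k • EuclideanSpace.single k (1 : ℝ)‖ := norm_sum_le _ _
    _ = ∑ k, |x k| := by simp [norm_smul]

lemma norm_linForm_le {p : ℕ} (c : Fin p → ℝ) {B : ℝ} (hc : ∀ k, |c k| ≤ B) :
    ‖linForm c‖ ≤ p * B := by
  obtain rfl | hp := Nat.eq_zero_or_pos p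
  · simp [linForm]
  have hB : 0 ≤ B := (abs_nonneg _).trans (hc ⟨0, hp⟩)
  refine ContinuousLinearMap.opNorm_le_bound _ (by positivity) fun x => ?_
  rw [linForm_apply]
  calc ‖∑ k, c k * x k‖ ≤ ∑ k, ‖c k * x k‖ := norm_sum_le _ _
    _ ≤ ∑ _k : Fin p, B * ‖x‖ := by
        refine Finset.sum_le_sum fun k _ => ?_
        rw [norm_mul]
        exact mul_le_mul (hc k) (PiLp.norm_apply_le x k) (norm_nonneg _) hB
    _ = p * B * ‖x‖ := by simp [mul_assoc]

lemma linForm_sub {p : ℕ} (c c' : Fin p → ℝ) :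
    linForm c - linForm c' = linForm fun k => c k - c' k := by
  simp [linForm, sub_smul, Finset.sum_sub_distrib]

lemma linForm_add {p : ℕ} (c c' : Fin p → ℝ) :
    linForm c + linForm c' = linForm fun k => c k + c' k := by
  simp [linForm, add_smul, Finset.sum_add_distrib]

lemma smul_linForm {p : ℕ} (a : ℝ) (c : Fin p → ℝ) :
    a • linForm c = linForm fun k => a * c k := by
  simp [linForm, mul_smul, Finset.smul_sum]

lemma sum_linForm {p : ℕ} {ι : Type*} (s : Finset ι) (c : ι → Fin p → ℝ) :
    ∑ i ∈ s, linForm (c i) = linForm fun k => ∑ i ∈ s, c i k := by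
  ext x
  simp only [_root_.sum_apply, linForm_apply, Finset.sum_mul]
  exact Finset.sum_comm

lemma continuousAt_partialD {p m : ℕ} (hm : m ≤ 2) (i : Fin m → Fin p)
    {g : EuclideanSpace ℝ (Fin p) → ℝ} {θ : EuclideanSpace ℝ (Fin p)} (hg : ContDiffAt ℝ 2 g θ) :
    ContinuousAt (partialD i g) θ := by
  have h : ContDiffAt ℝ 0 (iteratedFDeriv ℝ m g) θ :=
    hg.iteratedFDeriv_right (by rw [zero_add]; exact_mod_cast hm)
  exact h.continuousAt.eval_const _

lemma hasFDerivAt_partialD {p m : ℕ} (hm : m < 2) (i : Fin m → Fin p)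
    {g : EuclideanSpace ℝ (Fin p) → ℝ} {θ : EuclideanSpace ℝ (Fin p)} (hg : ContDiffAt ℝ 2 g θ) :
    HasFDerivAt (partialD i g)
      (linForm fun k => partialD (Fin.cons k i : Fin (m + 1) → Fin p) g θ) θ := by
  have h : ContDiffAt ℝ 1 (iteratedFDeriv ℝ m g) θ :=
    hg.iteratedFDeriv_right (by rw [add_comm]; exact_mod_cast hm)
  have h1 := (h.differentiableAt (by simp)).hasFDerivAt
  have h2 := h1.continuousMultilinear_apply_const
    (fun j => EuclideanSpace.single (i j) (1 : ℝ))
  refine HasFDerivAt.congr_fderiv (f := partialD i g) h2 ?_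
  refine ContinuousLinearMap.ext fun x => ?_
  have hx : x = ∑ k, x k • EuclideanSpace.single k (1 : ℝ) := by
    ext j; simp [Pi.single_apply]
  conv_lhs => rw [hx, map_sum]
  rw [linForm_apply]
  refine Finset.sum_congr rfl fun k _ => ?_
  rw [map_smul, smul_eq_mul, mul_comm]
  congr 1

section Interchange

variable {d p : ℕ} {𝓩 : Type*} (Ω : Set (EuclideanSpace ℝ (Fin d)))
  (ω : EuclideanSpace ℝ (Fin d) → ℝ)
  (φ : EuclideanSpace ℝ (Fin d) → 𝓩 → EuclideanSpace ℝ (Fin p) → ℝ)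

/-- The integral `∫_Ω D_α φ(v, z, θ) ω(v) dv` of a partial derivative of the integrand. -/
noncomputable def derivIntegral {m : ℕ} (i : Fin m → Fin p) (z : 𝓩)
    (θ : EuclideanSpace ℝ (Fin p)) : ℝ :=
  ∫ v in Ω, partialD i (φ v z) θ * ω v

/-- The cubature approximation `U_r(D_α φ(·, z, θ))` of `derivIntegral`. -/
noncomputable def derivApprox {r m : ℕ} (U : CubatureRule d r) (i : Fin m → Fin p) (z : 𝓩)
    (θ : EuclideanSpace ℝ (Fin p)) : ℝ :=
  U.apply fun v => partialD i (φ v z) θ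

variable {Ω ω φ}

lemma abs_derivIntegral_sub_le {Θ : Set (EuclideanSpace ℝ (Fin p))} {k r : ℕ}
    {U : CubatureRule d r} {ε : ℝ} (hε : 0 ≤ ε)
    (hU : cubatureError Ω ω φ Θ k U ≤ ENNReal.ofReal ε) {m : ℕ} (hm : m ≤ k) (i : Fin m → Fin p)
    (z : 𝓩) {θ : EuclideanSpace ℝ (Fin p)} (hθ : θ ∈ Θ) :
    |derivIntegral Ω ω φ i z θ - derivApprox φ U i z θ| ≤ ε := by
  have h : ‖derivIntegral Ω ω φ i z θ - derivApprox φ U i z θ‖ₑ ≤ ENNReal.ofReal ε := by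
    refine le_trans ?_ hU
    unfold cubatureError
    exact le_iSup₂_of_le m hm <| le_iSup₂_of_le i z <| le_iSup₂_of_le θ hθ le_rfl
  rwa [Real.enorm_eq_ofReal_abs, ENNReal.ofReal_le_ofReal_iff hε] at h

lemma continuousAt_derivApprox {r m : ℕ} (hm : m ≤ 2) {U : CubatureRule d r} (i : Fin m → Fin p)
    {z : 𝓩} {θ : EuclideanSpace ℝ (Fin p)} (h : ∀ j, ContDiffAt ℝ 2 (φ (U.node j) z) θ) :
    ContinuousAt (derivApprox φ U i z) θ := by
  unfold derivApprox CubatureRule.apply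
  exact tendsto_finsetSum _ fun j _ => (continuousAt_partialD hm i (h j)).const_mul _

lemma hasFDerivAt_derivApprox {r m : ℕ} (hm : m < 2) {U : CubatureRule d r} (i : Fin m → Fin p)
    {z : 𝓩} {θ : EuclideanSpace ℝ (Fin p)} (h : ∀ j, ContDiffAt ℝ 2 (φ (U.node j) z) θ) :
    HasFDerivAt (derivApprox φ U i z)
      (linForm fun k => derivApprox φ U (Fin.cons k i : Fin (m + 1) → Fin p) z θ) θ := by
  have h1 := HasFDerivAt.fun_sum (u := Finset.univ)
    fun j _ => (hasFDerivAt_partialD hm i (h j)).const_mul (U.weight j)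
  simp only [smul_linForm, sum_linForm] at h1
  exact h1

variable {Θ : Set (EuclideanSpace ℝ (Fin p))} {r : ℕ → ℕ} {V : (n : ℕ) → CubatureRule d (r n)}
  {e : ℕ → ℝ}

lemma continuousOn_derivIntegral (hφ : ∀ v ∈ Ω, ∀ z, ∀ θ ∈ Θ, ContDiffAt ℝ 2 (φ v z) θ)
    (hV : ∀ n j, (V n).node j ∈ Ω) (he : Tendsto e atTop (𝓝 0)) (he0 : ∀ n, 0 ≤ e n)
    (hVe : ∀ n, cubatureError Ω ω φ Θ 2 (V n) ≤ ENNReal.ofReal (e n))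
    {m : ℕ} (hm : m ≤ 2) (i : Fin m → Fin p) (z : 𝓩) :
    ContinuousOn (derivIntegral Ω ω φ i z) Θ := by
  have hu : TendstoUniformlyOn (fun n => derivApprox φ (V n) i z) (derivIntegral Ω ω φ i z)
      atTop Θ := by
    rw [Metric.tendstoUniformlyOn_iff]
    intro ε hε
    filter_upwards [he.eventually_lt_const hε] with n hn θ hθ
    exact (abs_derivIntegral_sub_le (he0 n) (hVe n) hm i z hθ).trans_lt hn
  exact hu.continuousOn <| Frequently.of_forall fun n θ hθ =>
    (continuousAt_derivApprox hm i fun j => hφ _ (hV n j) z θ hθ).continuousWithinAt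

/-- Differentiation under the integral sign. No domination is available in `v`; instead the
derivatives of the cubature approximations, which are finite sums, converge uniformly. -/
lemma hasFDerivAt_derivIntegral (hφ : ∀ v ∈ Ω, ∀ z, ∀ θ ∈ Θ, ContDiffAt ℝ 2 (φ v z) θ)
    (hV : ∀ n j, (V n).node j ∈ Ω) (he : Tendsto e atTop (𝓝 0)) (he0 : ∀ n, 0 ≤ e n)
    (hVe : ∀ n, cubatureError Ω ω φ Θ 2 (V n) ≤ ENNReal.ofReal (e n))
    {m : ℕ} (hm : m < 2) (i : Fin m → Fin p) (z : 𝓩) {θ : EuclideanSpace ℝ (Fin p)}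
    (hθ : θ ∈ interior Θ) :
    HasFDerivAt (derivIntegral Ω ω φ i z)
      (linForm fun k => derivIntegral Ω ω φ (Fin.cons k i : Fin (m + 1) → Fin p) z θ) θ := by
  refine hasFDerivAt_of_tendstoUniformlyOn (l := atTop) (s := interior Θ)
    (f := fun n => derivApprox φ (V n) i z)
    (f' := fun n θ => linForm fun k =>
      derivApprox φ (V n) (Fin.cons k i : Fin (m + 1) → Fin p) z θ)
    (g' := fun θ => linForm fun k =>
      derivIntegral Ω ω φ (Fin.cons k i : Fin (m + 1) → Fin p) z θ) isOpen_interior ?_ ?_ ?_ hθ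
  · rw [Metric.tendstoUniformlyOn_iff]
    intro ε hε
    have he' : Tendsto (fun n => (p : ℝ) * e n) atTop (𝓝 0) := by simpa using he.const_mul (p : ℝ)
    filter_upwards [he'.eventually_lt_const hε] with n hn θ hθ
    rw [dist_eq_norm, linForm_sub]
    exact (norm_linForm_le _ fun k => abs_derivIntegral_sub_le (he0 n) (hVe n) hm _ z
      (interior_subset hθ)).trans_lt hn
  · exact fun n θ hθ => hasFDerivAt_derivApprox hm i fun j =>
      hφ _ (hV n j) z θ (interior_subset hθ)
  · intro θ hθ
    rw [tendsto_iff_dist_tendsto_zero]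
    refine squeeze_zero (fun _ => dist_nonneg) (fun n => ?_) he
    rw [dist_comm]
    exact abs_derivIntegral_sub_le (he0 n) (hVe n) (by omega) i z (interior_subset hθ)

end Interchange

/-! ### Families of densities with bounded second derivatives -/

section Parametric

variable {p : ℕ} {𝓩 : Type*} [MeasurableSpace 𝓩]

/-- Partial derivatives are limits of difference quotients, hence measurable in the data. -/
lemma measurable_partial {V : Set (EuclideanSpace ℝ (Fin p))} (hV : IsOpen V)
    {F : 𝓩 → EuclideanSpace ℝ (Fin p) → ℝ} {F' : Fin p → 𝓩 → EuclideanSpace ℝ (Fin p) → ℝ}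
    (hF : ∀ θ ∈ V, Measurable fun z => F z θ)
    (hd : ∀ z, ∀ θ ∈ V, HasFDerivAt (F z) (linForm fun k => F' k z θ) θ)
    {θ : EuclideanSpace ℝ (Fin p)} (hθ : θ ∈ V) (k : Fin p) :
    Measurable fun z => F' k z θ := by
  obtain ⟨ε, hε, hball⟩ := Metric.isOpen_iff.1 hV θ hθ
  set c : ℕ → ℝ := fun n => ε / 2 * (1 / ((n : ℝ) + 1)) with hc
  have hc0 : ∀ n, 0 < c n := fun n => by positivity
  have hcε : ∀ n, c n < ε := fun n => by
    have : 1 / ((n : ℝ) + 1) ≤ 1 := by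
      rw [div_le_one (by positivity)]; linarith [(Nat.cast_nonneg n : (0 : ℝ) ≤ n)]
    have := mul_le_mul_of_nonneg_left this (half_pos hε).le
    simp only [hc]; linarith
  have hclim : Tendsto c atTop (𝓝[≠] 0) := by
    refine tendsto_nhdsWithin_iff.2 ⟨?_, Eventually.of_forall fun n => (hc0 n).ne'⟩
    simpa [hc] using (tendsto_one_div_add_atTop_nhds_zero_nat (𝕜 := ℝ)).const_mul (ε / 2)
  refine measurable_of_tendsto_metrizable
    (f := fun n z => (c n)⁻¹ • (F z (θ + c n • EuclideanSpace.single k (1 : ℝ)) - F z θ))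
    (fun n => ?_) ?_
  · have hmem : θ + c n • EuclideanSpace.single k (1 : ℝ) ∈ V :=
      hball (by simp [norm_smul, abs_of_pos (hc0 n), hcε n])
    exact Measurable.const_smul (M := ℝ) (α := 𝓩) ((hF _ hmem).sub (hF _ hθ)) (c n)⁻¹
  · refine tendsto_pi_nhds.2 fun z => ?_
    have h := ((hd z θ hθ).hasLineDerivAt (EuclideanSpace.single k (1 : ℝ))).tendsto_slope_zero
    rw [linForm_single] at h
    exact h.comp hclim

/-- If the total mass does not depend on the parameter, the derivative integrates to zero. -/
lemma integral_partial_eq_zero {ν : Measure 𝓩} [IsFiniteMeasure ν]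
    {V : Set (EuclideanSpace ℝ (Fin p))} (hV : IsOpen V)
    {F : 𝓩 → EuclideanSpace ℝ (Fin p) → ℝ} {F' : Fin p → 𝓩 → EuclideanSpace ℝ (Fin p) → ℝ}
    {M c : ℝ} (hF : ∀ θ ∈ V, Measurable fun z => F z θ) (hFM : ∀ z, ∀ θ ∈ V, |F z θ| ≤ M)
    (hF'M : ∀ k z, ∀ θ ∈ V, |F' k z θ| ≤ M)
    (hd : ∀ z, ∀ θ ∈ V, HasFDerivAt (F z) (linForm fun k => F' k z θ) θ)
    (hc : ∀ θ ∈ V, ∫ z, F z θ ∂ν = c)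
    {θ : EuclideanSpace ℝ (Fin p)} (hθ : θ ∈ V) (k : Fin p) :
    ∫ z, F' k z θ ∂ν = 0 := by
  have hmeas : AEStronglyMeasurable (fun z => linForm fun k => F' k z θ) ν := by
    unfold linForm
    refine Finset.aestronglyMeasurable_fun_sum _ fun k _ => ?_
    exact (measurable_partial hV hF hd hθ k).aestronglyMeasurable.smul_const _
  have hbound : ∀ z, ∀ θ ∈ V, ‖linForm fun k => F' k z θ‖ ≤ p * M := fun z θ hθ =>
    norm_linForm_le _ fun k => hF'M k z θ hθ
  have h1 : HasFDerivAt (fun θ => ∫ z, F z θ ∂ν) (∫ z, (linForm fun k => F' k z θ) ∂ν) θ := by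
    refine hasFDerivAt_integral_of_dominated_of_fderiv_le (F := fun θ z => F z θ)
      (F' := fun θ z => linForm fun k => F' k z θ) (bound := fun _ => p * M)
      (hV.mem_nhds hθ) ?_ ?_ hmeas ?_ (integrable_const _) ?_
    · filter_upwards [hV.mem_nhds hθ] with x hx using (hF x hx).aestronglyMeasurable
    · exact Integrable.of_bound (hF θ hθ).aestronglyMeasurable M
        (Eventually.of_forall fun z => hFM z θ hθ)
    · exact Eventually.of_forall hbound
    · exact Eventually.of_forall hd
  have h2 : HasFDerivAt (fun θ => ∫ z, F z θ ∂ν) (0 : EuclideanSpace ℝ (Fin p) →L[ℝ] ℝ) θ := by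
    refine (hasFDerivAt_const c θ).congr_of_eventuallyEq ?_
    filter_upwards [hV.mem_nhds hθ] with x hx using hc x hx
  have h3 := congrArg (fun L => L (EuclideanSpace.single k (1 : ℝ))) (h1.unique h2)
  have hint : Integrable (fun z => linForm fun k => F' k z θ) ν :=
    Integrable.of_bound hmeas (p * M) (Eventually.of_forall fun z => hbound z θ hθ)
  simp only [ContinuousLinearMap.integral_apply hint, linForm_single] at h3
  simpa using h3

/-- A family `f(·, θ)`, `θ ∈ Θ`, of probability densities with respect to `ν`, bounded and bounded
away from zero, with first and second partial derivatives `f₁ k = ∂_k f` and `f₂ k i = ∂_k ∂_i f`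
in the interior of `Θ` that extend continuously and boundedly to `Θ`. -/
structure RegularFamily (ν : Measure 𝓩) (Θ : Set (EuclideanSpace ℝ (Fin p)))
    (f : 𝓩 → EuclideanSpace ℝ (Fin p) → ℝ) (f₁ : Fin p → 𝓩 → EuclideanSpace ℝ (Fin p) → ℝ)
    (f₂ : Fin p → Fin p → 𝓩 → EuclideanSpace ℝ (Fin p) → ℝ) (δ M : ℝ) : Prop where
  isCompact : IsCompact Θ
  pos : 0 < δ
  lt : ∀ z, ∀ θ ∈ Θ, δ < f z θ
  measurable : ∀ θ ∈ Θ, Measurable fun z => f z θ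
  lintegral : ∀ θ ∈ Θ, ∫⁻ z, ENNReal.ofReal (f z θ) ∂ν = 1
  bound : ∀ z, ∀ θ ∈ Θ, |f z θ| ≤ M
  bound₁ : ∀ i z, ∀ θ ∈ Θ, |f₁ i z θ| ≤ M
  bound₂ : ∀ k i z, ∀ θ ∈ Θ, |f₂ k i z θ| ≤ M
  cont : ∀ z, ContinuousOn (f z) Θ
  cont₁ : ∀ i z, ContinuousOn (f₁ i z) Θ
  cont₂ : ∀ k i z, ContinuousOn (f₂ k i z) Θ
  deriv : ∀ z, ∀ θ ∈ interior Θ, HasFDerivAt (f z) (linForm fun k => f₁ k z θ) θ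
  deriv₁ : ∀ i z, ∀ θ ∈ interior Θ, HasFDerivAt (f₁ i z) (linForm fun k => f₂ k i z θ) θ

variable (f : 𝓩 → EuclideanSpace ℝ (Fin p) → ℝ)
  (f₁ : Fin p → 𝓩 → EuclideanSpace ℝ (Fin p) → ℝ)
  (f₂ : Fin p → Fin p → 𝓩 → EuclideanSpace ℝ (Fin p) → ℝ)

/-- The law with density `f(·, θ)`. -/
noncomputable def law (ν : Measure 𝓩) (θ : EuclideanSpace ℝ (Fin p)) : Measure 𝓩 :=
  ν.withDensity fun z => ENNReal.ofReal (f z θ)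

/-- The `i`-th component `∂_i log f = ∂_i f / f` of the score. -/
noncomputable def score (i : Fin p) (z : 𝓩) (θ : EuclideanSpace ℝ (Fin p)) : ℝ :=
  f₁ i z θ / f z θ

/-- The entry `∂_k ∂_i log f = ∂_k ∂_i f / f - (∂_k log f) (∂_i log f)` of the Hessian of the
log-likelihood. -/
noncomputable def hess (k i : Fin p) (z : 𝓩) (θ : EuclideanSpace ℝ (Fin p)) : ℝ :=
  f₂ k i z θ / f z θ - score f f₁ k z θ * score f f₁ i z θ

variable {f f₁ f₂}

namespace RegularFamily

variable {ν : Measure 𝓩} {Θ : Set (EuclideanSpace ℝ (Fin p))} {δ M : ℝ}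
  (h : RegularFamily ν Θ f f₁ f₂ δ M)

include h

lemma f_pos (z : 𝓩) {θ : EuclideanSpace ℝ (Fin p)} (hθ : θ ∈ Θ) : 0 < f z θ :=
  h.pos.trans (h.lt z θ hθ)

lemma f_le (z : 𝓩) {θ : EuclideanSpace ℝ (Fin p)} (hθ : θ ∈ Θ) : f z θ ≤ M :=
  (le_abs_self _).trans (h.bound z θ hθ)

/-- The lower bound on the densities forces `ν` to be finite. -/
lemma isFiniteMeasure {θ : EuclideanSpace ℝ (Fin p)} (hθ : θ ∈ Θ) : IsFiniteMeasure ν := by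
  refine ⟨?_⟩
  have h1 : ENNReal.ofReal δ * ν Set.univ ≤ 1 := by
    rw [← lintegral_const, ← h.lintegral θ hθ]
    exact lintegral_mono fun z => ENNReal.ofReal_le_ofReal (h.lt z θ hθ).le
  by_contra hν
  rw [not_lt, top_le_iff] at hν
  rw [hν, ENNReal.mul_top (by simpa using h.pos)] at h1
  exact absurd h1 (by simp)

lemma isProbabilityMeasure_law {θ : EuclideanSpace ℝ (Fin p)} (hθ : θ ∈ Θ) :
    IsProbabilityMeasure (law f ν θ) := by
  refine ⟨?_⟩
  rw [law, withDensity_apply _ MeasurableSet.univ, Measure.restrict_univ, h.lintegral θ hθ]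

lemma integrable_f {θ : EuclideanSpace ℝ (Fin p)} (hθ : θ ∈ Θ) :
    Integrable (fun z => f z θ) ν := by
  have := h.isFiniteMeasure hθ
  exact Integrable.of_bound (h.measurable θ hθ).aestronglyMeasurable M
    (Eventually.of_forall fun z => h.bound z θ hθ)

lemma integral_f {θ : EuclideanSpace ℝ (Fin p)} (hθ : θ ∈ Θ) : ∫ z, f z θ ∂ν = 1 := by
  rw [integral_eq_lintegral_of_nonneg_ae (Eventually.of_forall fun z => (h.f_pos z hθ).le)
    (h.measurable θ hθ).aestronglyMeasurable, h.lintegral θ hθ, ENNReal.toReal_one]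

lemma integral_law {θ : EuclideanSpace ℝ (Fin p)} (hθ : θ ∈ Θ) (g : 𝓩 → ℝ) :
    ∫ z, g z ∂(law f ν θ) = ∫ z, f z θ * g z ∂ν := by
  rw [law, integral_withDensity_eq_integral_toReal_smul
    (h.measurable θ hθ).ennreal_ofReal (Eventually.of_forall fun z => ENNReal.ofReal_lt_top)]
  refine integral_congr_ae (Eventually.of_forall fun z => ?_)
  simp [ENNReal.toReal_ofReal (h.f_pos z hθ).le]

lemma measurable₁ (i : Fin p) {θ : EuclideanSpace ℝ (Fin p)} (hθ : θ ∈ interior Θ) :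
    Measurable fun z => f₁ i z θ :=
  measurable_partial isOpen_interior (fun θ hθ => h.measurable θ (interior_subset hθ)) h.deriv hθ i

lemma measurable₂ (k i : Fin p) {θ : EuclideanSpace ℝ (Fin p)} (hθ : θ ∈ interior Θ) :
    Measurable fun z => f₂ k i z θ :=
  measurable_partial (F' := fun k => f₂ k i) isOpen_interior (fun _ hθ => h.measurable₁ i hθ)
    (h.deriv₁ i) hθ k

lemma integral_f₁ (i : Fin p) {θ : EuclideanSpace ℝ (Fin p)} (hθ : θ ∈ interior Θ) :
    ∫ z, f₁ i z θ ∂ν = 0 := by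
  have := h.isFiniteMeasure (interior_subset hθ)
  exact integral_partial_eq_zero (c := 1) isOpen_interior
    (fun θ hθ => h.measurable θ (interior_subset hθ))
    (fun z θ hθ => h.bound z θ (interior_subset hθ))
    (fun k z θ hθ => h.bound₁ k z θ (interior_subset hθ)) h.deriv
    (fun θ hθ => h.integral_f (interior_subset hθ)) hθ i

lemma integral_f₂ (k i : Fin p) {θ : EuclideanSpace ℝ (Fin p)} (hθ : θ ∈ interior Θ) :
    ∫ z, f₂ k i z θ ∂ν = 0 := by
  have := h.isFiniteMeasure (interior_subset hθ)
  exact integral_partial_eq_zero (c := 0) (F' := fun k => f₂ k i) isOpen_interior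
    (fun θ hθ => h.measurable₁ i hθ)
    (fun z θ hθ => h.bound₁ i z θ (interior_subset hθ))
    (fun k z θ hθ => h.bound₂ k i z θ (interior_subset hθ)) (h.deriv₁ i)
    (fun θ hθ => h.integral_f₁ i hθ) hθ k

lemma measurable_score (i : Fin p) {θ : EuclideanSpace ℝ (Fin p)} (hθ : θ ∈ interior Θ) :
    Measurable fun z => score f f₁ i z θ :=
  (h.measurable₁ i hθ).div (h.measurable θ (interior_subset hθ))

lemma measurable_hess (k i : Fin p) {θ : EuclideanSpace ℝ (Fin p)} (hθ : θ ∈ interior Θ) :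
    Measurable fun z => hess f f₁ f₂ k i z θ :=
  ((h.measurable₂ k i hθ).div (h.measurable θ (interior_subset hθ))).sub
    ((h.measurable_score k hθ).mul (h.measurable_score i hθ))

lemma abs_score_le (i : Fin p) (z : 𝓩) {θ : EuclideanSpace ℝ (Fin p)} (hθ : θ ∈ Θ) :
    |score f f₁ i z θ| ≤ M / δ := by
  rw [score, abs_div, abs_of_pos (h.f_pos z hθ)]
  exact div_le_div₀ ((abs_nonneg _).trans (h.bound₁ i z θ hθ)) (h.bound₁ i z θ hθ) h.pos
    (h.lt z θ hθ).le

lemma abs_hess_le (k i : Fin p) (z : 𝓩) {θ : EuclideanSpace ℝ (Fin p)} (hθ : θ ∈ Θ) :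
    |hess f f₁ f₂ k i z θ| ≤ M / δ + M / δ * (M / δ) := by
  have h2 : |f₂ k i z θ / f z θ| ≤ M / δ := by
    rw [abs_div, abs_of_pos (h.f_pos z hθ)]
    exact div_le_div₀ ((abs_nonneg _).trans (h.bound₂ k i z θ hθ)) (h.bound₂ k i z θ hθ) h.pos
      (h.lt z θ hθ).le
  refine (abs_sub _ _).trans (add_le_add h2 ?_)
  rw [abs_mul]
  exact mul_le_mul (h.abs_score_le k z hθ) (h.abs_score_le i z hθ) (abs_nonneg _)
    ((abs_nonneg _).trans (h.abs_score_le k z hθ))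

lemma continuousOn_score (i : Fin p) (z : 𝓩) : ContinuousOn (score f f₁ i z) Θ :=
  (h.cont₁ i z).div (h.cont z) fun _ hθ => (h.f_pos z hθ).ne'

lemma continuousOn_hess (k i : Fin p) (z : 𝓩) : ContinuousOn (hess f f₁ f₂ k i z) Θ :=
  ((h.cont₂ k i z).div (h.cont z) fun _ hθ => (h.f_pos z hθ).ne').sub
    ((h.continuousOn_score k z).mul (h.continuousOn_score i z))

lemma continuousOn_log (z : 𝓩) : ContinuousOn (fun θ => Real.log (f z θ)) Θ :=
  (h.cont z).log fun _ hθ => (h.f_pos z hθ).ne'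

lemma abs_log_le (z : 𝓩) {θ : EuclideanSpace ℝ (Fin p)} (hθ : θ ∈ Θ) :
    |Real.log (f z θ)| ≤ max |Real.log δ| |Real.log M| :=
  abs_le_max_abs_abs (Real.log_le_log h.pos (h.lt z θ hθ).le)
    (Real.log_le_log (h.f_pos z hθ) (h.f_le z hθ))

lemma hasFDerivAt_log (z : 𝓩) {θ : EuclideanSpace ℝ (Fin p)} (hθ : θ ∈ interior Θ) :
    HasFDerivAt (fun θ => Real.log (f z θ)) (linForm fun k => score f f₁ k z θ) θ := by
  have h1 := (h.deriv z θ hθ).log (h.f_pos z (interior_subset hθ)).ne'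
  rw [smul_linForm] at h1
  refine h1.congr_fderiv ?_
  congr 1
  ext k
  rw [score]; ring

lemma hasFDerivAt_score (i : Fin p) (z : 𝓩) {θ : EuclideanSpace ℝ (Fin p)}
    (hθ : θ ∈ interior Θ) :
    HasFDerivAt (score f f₁ i z) (linForm fun k => hess f f₁ f₂ k i z θ) θ := by
  have hne := (h.f_pos z (interior_subset hθ)).ne'
  have h1 := (h.deriv₁ i z θ hθ).mul ((hasDerivAt_inv hne).comp_hasFDerivAt θ (h.deriv z θ hθ))
  rw [smul_linForm, smul_linForm, smul_linForm, linForm_add] at h1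
  have h2 : HasFDerivAt (score f f₁ i z) _ θ := h1
  refine h2.congr_fderiv ?_
  congr 1
  ext k
  simp only [hess, score, Function.comp]
  field_simp
  ring

lemma gradient_log (z : 𝓩) {θ : EuclideanSpace ℝ (Fin p)} (hθ : θ ∈ interior Θ) (i : Fin p) :
    gradient (fun θ => Real.log (f z θ)) θ i = score f f₁ i z θ := by
  have h1 : inner ℝ (gradient (fun θ => Real.log (f z θ)) θ) (EuclideanSpace.single i (1 : ℝ)) =
      score f f₁ i z θ := by
    rw [gradient, InnerProductSpace.toDual_symm_apply, (h.hasFDerivAt_log z hθ).fderiv,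
      linForm_single]
  rw [← h1, EuclideanSpace.inner_single_right]
  simp

lemma fisherInformation_apply {θ : EuclideanSpace ℝ (Fin p)} (hθ : θ ∈ interior Θ)
    (i j : Fin p) : fisherInformation (law f ν θ) f θ i j =
      ∫ z, score f f₁ i z θ * score f f₁ j z θ ∂(law f ν θ) := by
  simp only [fisherInformation, Matrix.of_apply, h.gradient_log _ hθ]

lemma integrable_score {μ : Measure 𝓩} [IsFiniteMeasure μ] (i : Fin p)
    {θ : EuclideanSpace ℝ (Fin p)} (hθ : θ ∈ interior Θ) :
    Integrable (fun z => score f f₁ i z θ) μ :=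
  Integrable.of_bound (h.measurable_score i hθ).aestronglyMeasurable (M / δ)
    (Eventually.of_forall fun z => h.abs_score_le i z (interior_subset hθ))

lemma integrable_score_mul {μ : Measure 𝓩} [IsFiniteMeasure μ] (i j : Fin p)
    {θ : EuclideanSpace ℝ (Fin p)} (hθ : θ ∈ interior Θ) :
    Integrable (fun z => score f f₁ i z θ * score f f₁ j z θ) μ :=
  (h.integrable_score j hθ).bdd_mul (h.measurable_score i hθ).aestronglyMeasurable
    (Eventually.of_forall fun z => h.abs_score_le i z (interior_subset hθ))

/-- The score is centered. -/
lemma integral_score (i : Fin p) {θ : EuclideanSpace ℝ (Fin p)} (hθ : θ ∈ interior Θ) :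
    ∫ z, score f f₁ i z θ ∂(law f ν θ) = 0 := by
  rw [h.integral_law (interior_subset hθ), ← h.integral_f₁ i hθ]
  refine integral_congr_ae (Eventually.of_forall fun z => ?_)
  exact mul_div_cancel₀ _ (h.f_pos z (interior_subset hθ)).ne'

/-- The information identity: the expected Hessian of the log-likelihood is minus the Fisher
information. -/
lemma integral_hess (k i : Fin p) {θ : EuclideanSpace ℝ (Fin p)} (hθ : θ ∈ interior Θ) :
    ∫ z, hess f f₁ f₂ k i z θ ∂(law f ν θ) = -fisherInformation (law f ν θ) f θ k i := by
  have hθ' := interior_subset hθ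
  have := h.isProbabilityMeasure_law hθ'
  rw [h.fisherInformation_apply hθ]
  have h0 : ∫ z, f₂ k i z θ / f z θ ∂(law f ν θ) = 0 := by
    rw [h.integral_law hθ', ← h.integral_f₂ k i hθ]
    refine integral_congr_ae (Eventually.of_forall fun z => ?_)
    exact mul_div_cancel₀ _ (h.f_pos z hθ').ne'
  have hint : Integrable (fun z => f₂ k i z θ / f z θ) (law f ν θ) := by
    refine Integrable.of_bound
      ((h.measurable₂ k i hθ).div (h.measurable θ hθ')).aestronglyMeasurable (M / δ)
      (Eventually.of_forall fun z => ?_)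
    rw [Real.norm_eq_abs, abs_div, abs_of_pos (h.f_pos z hθ')]
    exact div_le_div₀ ((abs_nonneg _).trans (h.bound₂ k i z θ hθ')) (h.bound₂ k i z θ hθ') h.pos
      (h.lt z θ hθ').le
  simp only [hess]
  rw [integral_sub hint (h.integrable_score_mul k i hθ), h0, zero_sub]

lemma integrable_log {μ : Measure 𝓩} [IsFiniteMeasure μ] {θ : EuclideanSpace ℝ (Fin p)}
    (hθ : θ ∈ Θ) : Integrable (fun z => Real.log (f z θ)) μ :=
  Integrable.of_bound (h.measurable θ hθ).log.aestronglyMeasurable _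
    (Eventually.of_forall fun z => h.abs_log_le z hθ)

/-- The information inequality: the true parameter is the only maximizer of the expected
log-likelihood. -/
lemma integral_log_lt {θ θ₀ : EuclideanSpace ℝ (Fin p)} (hθ : θ ∈ Θ) (hθ₀ : θ₀ ∈ Θ)
    (hne : ¬ (fun z => f z θ) =ᵐ[ν] fun z => f z θ₀) :
    ∫ z, Real.log (f z θ) ∂(law f ν θ₀) < ∫ z, Real.log (f z θ₀) ∂(law f ν θ₀) := by
  have := h.isFiniteMeasure hθ
  -- The integrand `(x - y) - y (log x - log y)` is nonnegative and vanishes only for `x = y`.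
  set g : 𝓩 → ℝ := fun z =>
    (f z θ - f z θ₀) - (f z θ₀ * Real.log (f z θ) - f z θ₀ * Real.log (f z θ₀)) with hg
  have hg_eq : ∀ z, g z = f z θ₀ * (f z θ / f z θ₀ - 1 - Real.log (f z θ / f z θ₀)) := fun z => by
    have h0 := (h.f_pos z hθ₀).ne'
    rw [Real.log_div (h.f_pos z hθ).ne' h0, hg]
    field_simp
  have hquot : ∀ z, 0 < f z θ / f z θ₀ := fun z => div_pos (h.f_pos z hθ) (h.f_pos z hθ₀)
  have hg0 : ∀ z, 0 ≤ g z := fun z => by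
    rw [hg_eq]
    exact mul_nonneg (h.f_pos z hθ₀).le (by linarith [Real.log_le_sub_one_of_pos (hquot z)])
  have hint : ∀ θ' ∈ Θ, Integrable (fun z => f z θ₀ * Real.log (f z θ')) ν := fun θ' hθ' =>
    (h.integrable_log hθ').bdd_mul (h.measurable θ₀ hθ₀).aestronglyMeasurable
      (Eventually.of_forall fun z => h.bound z θ₀ hθ₀)
  have hgi : Integrable g ν :=
    ((h.integrable_f hθ).sub (h.integrable_f hθ₀)).sub ((hint θ hθ).sub (hint θ₀ hθ₀))
  have hI : ∫ z, g z ∂ν = ∫ z, Real.log (f z θ₀) ∂(law f ν θ₀) -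
      ∫ z, Real.log (f z θ) ∂(law f ν θ₀) := by
    have h1 := integral_sub
      ((h.integrable_f hθ).sub (h.integrable_f hθ₀)) ((hint θ hθ).sub (hint θ₀ hθ₀))
    simp only [Pi.sub_apply] at h1
    rw [h.integral_law hθ₀, h.integral_law hθ₀, hg, h1, integral_sub (h.integrable_f hθ) (h.integrable_f hθ₀), integral_sub (hint θ hθ) (hint θ₀ hθ₀),
      h.integral_f hθ, h.integral_f hθ₀]
    ring
  have hpos : 0 < ∫ z, g z ∂ν := by
    refine lt_of_le_of_ne (integral_nonneg hg0) fun h0 => hne ?_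
    have h1 := (integral_eq_zero_iff_of_nonneg hg0 hgi).1 h0.symm
    filter_upwards [h1] with z hz
    by_contra hzne
    have h2 : f z θ / f z θ₀ ≠ 1 := fun h3 => hzne ((div_eq_one_iff_eq (h.f_pos z hθ₀).ne').1 h3)
    have h3 := Real.log_lt_sub_one_of_pos (hquot z) h2
    rw [hg_eq] at hz
    exact (mul_pos (h.f_pos z hθ₀) (by linarith : 0 < f z θ / f z θ₀ - 1 -
      Real.log (f z θ / f z θ₀))).ne' hz
  linarith

end RegularFamily

end Parametric

/-! ### Events of probability tending to one -/

section Probability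

variable {S : Type*} [MeasurableSpace S] {P : Measure S}

/-- The filter on `ℕ × S` of the sequences of events whose outer probability tends to one. Along
this filter, `∀ᶠ` means "with probability tending to one", and `Tendsto` to a neighborhood
filter is convergence in probability. The events need not be measurable. -/
def whp (P : Measure S) : Filter (ℕ × S) where
  sets := {A | Tendsto (fun n => P {s | (n, s) ∉ A}) atTop (𝓝 0)}
  univ_sets := by simp
  sets_of_superset {A B} hA hAB := by
    refine tendsto_of_tendsto_of_tendsto_of_le_of_le tendsto_const_nhds hA (fun _ => zero_le) ?_
    exact fun n => measure_mono fun s hs hsA => hs (hAB hsA)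
  inter_sets {A B} hA hB := by
    have hAB := Tendsto.add (show Tendsto _ _ _ from hA) (show Tendsto _ _ _ from hB)
    rw [add_zero] at hAB
    refine tendsto_of_tendsto_of_tendsto_of_le_of_le tendsto_const_nhds hAB (fun _ => zero_le) ?_
    refine fun n => (measure_mono fun s hs => ?_).trans (measure_union_le _ _)
    by_contra hcon
    simp only [Set.mem_union, Set.mem_ofPred_eq, not_or, not_not] at hcon
    exact hs hcon

lemma eventually_whp {Q : ℕ × S → Prop} :
    (∀ᶠ x in whp P, Q x) ↔ Tendsto (fun n => P {s | ¬ Q (n, s)}) atTop (𝓝 0) := Iff.rfl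

lemma eventually_whp_of_eventually {Q : ℕ → Prop} (h : ∀ᶠ n in atTop, Q n) :
    ∀ᶠ x in whp P, Q x.1 := by
  rw [eventually_whp]
  refine tendsto_const_nhds.congr' ?_
  filter_upwards [h] with n hn
  simp [hn]

lemma eventually_whp_of_ae {Q : ℕ → S → Prop} (h : ∀ n, ∀ᵐ s ∂P, Q n s) :
    ∀ᶠ x in whp P, Q x.1 x.2 := by
  rw [eventually_whp]
  refine tendsto_const_nhds.congr fun n => ?_
  exact (ae_iff.1 (h n)).symm

lemma TendstoZeroInProbability.eventually_lt {X : ℕ → S → ℝ≥0∞}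
    (h : TendstoZeroInProbability P X) {ε : ℝ≥0∞} (hε : 0 < ε) :
    ∀ᶠ x in whp P, X x.1 x.2 < ε := by
  rw [eventually_whp]
  simpa only [not_lt] using h ε hε

/-! ### The uniform law of large numbers -/

/-- A random continuous function on a compact space is measurable as soon as its values are, since
closed balls for the uniform norm are cut out by the values on a countable dense set. -/
lemma measurable_continuousMap {X 𝓩 : Type*} [TopologicalSpace X] [CompactSpace X]
    [TopologicalSpace.SeparableSpace X] [SecondCountableTopology C(X, ℝ)]
    [MeasurableSpace C(X, ℝ)] [BorelSpace C(X, ℝ)] [MeasurableSpace 𝓩] {G : 𝓩 → C(X, ℝ)}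
    (hG : ∀ x, Measurable fun z => G z x) : Measurable G := by
  obtain ⟨D, hDc, hD⟩ := TopologicalSpace.exists_countable_dense X
  have hball : ∀ (g : C(X, ℝ)) (r : ℝ), 0 ≤ r → MeasurableSet (G ⁻¹' Metric.closedBall g r) := by
    intro g r hr
    have h1 : G ⁻¹' Metric.closedBall g r = ⋂ x ∈ D, {z | |G z x - g x| ≤ r} := by
      ext z
      simp only [Set.mem_preimage, Metric.mem_closedBall, Set.mem_iInter, Set.mem_ofPred_eq]
      rw [ContinuousMap.dist_le hr]
      refine ⟨fun h x _ => h x, fun h x => ?_⟩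
      have hcl : IsClosed {x | |G z x - g x| ≤ r} :=
        isClosed_le (by fun_prop) continuous_const
      exact hcl.closure_subset_iff.2 (fun y hy => h y hy) (hD x)
    rw [h1]
    refine MeasurableSet.biInter hDc fun x _ => ?_
    exact measurableSet_le ((hG x).sub_const _).abs measurable_const
  refine measurable_of_isOpen fun O hO => ?_
  have hr : ∀ g : O, ∃ r : ℝ, 0 < r ∧ Metric.closedBall (g : C(X, ℝ)) r ⊆ O := fun g =>
    Metric.nhds_basis_closedBall.mem_iff.1 (hO.mem_nhds g.2)
  choose r hr0 hrO using hr
  obtain ⟨T, hTc, hT⟩ := TopologicalSpace.isOpen_iUnion_countable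
    (fun g : O => Metric.ball (g : C(X, ℝ)) (r g)) fun _ => Metric.isOpen_ball
  have hOT : O = ⋃ g ∈ T, Metric.closedBall (g : C(X, ℝ)) (r g) := by
    refine Set.Subset.antisymm (fun g hg => ?_) (Set.iUnion₂_subset fun g _ => hrO g)
    have h1 : g ∈ ⋃ g : O, Metric.ball (g : C(X, ℝ)) (r g) :=
      Set.mem_iUnion.2 ⟨⟨g, hg⟩, Metric.mem_ball_self (hr0 _)⟩
    rw [← hT] at h1
    exact Set.iUnion₂_mono (fun _ _ => Metric.ball_subset_closedBall) h1
  rw [hOT, Set.preimage_iUnion₂]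
  exact MeasurableSet.biUnion hTc fun g _ => hball _ _ (hr0 g).le

/-- The uniform law of large numbers over a compact set, obtained from the strong law in the
Banach space of continuous functions. -/
lemma uniform_law_of_large_numbers [IsProbabilityMeasure P] {E 𝓩 : Type*} [MetricSpace E]
    [MeasurableSpace 𝓩] {K : Set E} (hK : IsCompact K) {μ : Measure 𝓩} {z : ℕ → S → 𝓩}
    (hz_meas : ∀ i, Measurable (z i)) (hz_indep : iIndepFun z P) (hz_law : ∀ i, P.map (z i) = μ)
    {g : 𝓩 → E → ℝ} {B : ℝ} (hg : ∀ θ ∈ K, Measurable fun z => g z θ)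
    (hgc : ∀ z, ContinuousOn (g z) K) (hgB : ∀ z, ∀ θ ∈ K, |g z θ| ≤ B) :
    ContinuousOn (fun θ => ∫ z, g z θ ∂μ) K ∧ ∀ ε > 0, ∀ᶠ x in whp P, ∀ θ ∈ K,
      |(x.1 : ℝ)⁻¹ * ∑ i ∈ Finset.range x.1, g (z i x.2) θ - ∫ z, g z θ ∂μ| < ε := by
  have : CompactSpace K := isCompact_iff_compactSpace.1 hK
  borelize C(K, ℝ)
  set G : 𝓩 → C(K, ℝ) := fun z => ⟨fun θ => g z θ, (hgc z).domRestrict⟩ with hGdef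
  have hG : Measurable G := measurable_continuousMap fun θ => hg θ θ.2
  set X : ℕ → S → C(K, ℝ) := fun i s => G (z i s) with hX
  have hXm : ∀ i, Measurable (X i) := fun i => hG.comp (hz_meas i)
  have hXi : Integrable (X 0) P := by
    refine Integrable.of_bound (hXm 0).aestronglyMeasurable (max B 0)
      (Eventually.of_forall fun s => ?_)
    rw [ContinuousMap.norm_le _ (le_max_right _ _)]
    exact fun θ => (hgB _ θ θ.2).trans (le_max_left _ _)
  have hlln := strong_law_ae X hXi
    (fun i j hij => (hz_indep.indepFun hij).comp hG hG)
    (fun i => IdentDistrib.comp ⟨(hz_meas i).aemeasurable, (hz_meas 0).aemeasurable,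
      by rw [hz_law, hz_law]⟩ hG)
  have hmeas := tendstoInMeasure_of_tendsto_ae
    (f := fun (n : ℕ) s => (n : ℝ)⁻¹ • ∑ i ∈ Finset.range n, X i s)
    (fun n => Measurable.aestronglyMeasurable (by fun_prop)) hlln
  set L : C(K, ℝ) := ∫ s, X 0 s ∂P with hL
  have hLeval : ∀ θ : K, L θ = ∫ z, g z θ ∂μ := fun θ => by
    have h1 := (ContinuousMap.evalCLM ℝ θ).integral_comp_comm hXi
    rw [← hz_law 0, integral_map (hz_meas 0).aemeasurable (hg θ θ.2).aestronglyMeasurable]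
    exact h1.symm
  refine ⟨?_, fun ε hε => ?_⟩
  · rw [continuousOn_iff_continuous_domRestrict]
    convert! L.continuous using 1
    ext θ
    exact (hLeval θ).symm
  · have h1 := tendstoInMeasure_iff_norm.1 hmeas ε hε
    have h2 : ∀ᶠ x in whp P, ‖(x.1 : ℝ)⁻¹ • ∑ i ∈ Finset.range x.1, X i x.2 - L‖ < ε := by
      rw [eventually_whp]
      simpa only [not_lt] using h1
    filter_upwards [h2] with x hx θ hθ
    have h3 := (((x.1 : ℝ)⁻¹ • ∑ i ∈ Finset.range x.1, X i x.2 - L).norm_coe_le_norm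
      ⟨θ, hθ⟩).trans_lt hx
    rw [ContinuousMap.sub_apply, hLeval, ContinuousMap.smul_apply, ContinuousMap.sum_apply] at h3
    exact h3

/-! ### The central limit theorem and Slutsky's theorem in `ℝ^p` -/

/-- The central limit theorem for bounded random vectors, by reduction to the projections on lines
(Cramér-Wold). -/
lemma tendstoInDistribution_multivariateGaussian [IsProbabilityMeasure P] {p : ℕ}
    {X : ℕ → S → EuclideanSpace ℝ (Fin p)} (hX : ∀ i, Measurable (X i)) (hindep : iIndepFun X P)
    (hident : ∀ i, IdentDistrib (X i) (X 0) P P) {B : ℝ} (hB : ∀ s, ‖X 0 s‖ ≤ B)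
    {C : Matrix (Fin p) (Fin p) ℝ} (hC : C.PosSemidef)
    (hmean : ∀ t : EuclideanSpace ℝ (Fin p), ∫ s, inner ℝ (X 0 s) t ∂P = 0)
    (hcov : ∀ t : EuclideanSpace ℝ (Fin p), ∫ s, inner ℝ (X 0 s) t ^ 2 ∂P = t ⬝ᵥ C.mulVec t) :
    TendstoInDistribution (fun (n : ℕ) s => (Real.sqrt n)⁻¹ • ∑ i ∈ Finset.range n, X i s) atTop id
      (fun _ => P) (multivariateGaussian 0 C) := by
  have hm : ∀ n : ℕ, AEMeasurable (fun s => (Real.sqrt n)⁻¹ • ∑ i ∈ Finset.range n, X i s) P :=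
    fun n => Measurable.aemeasurable (by fun_prop)
  refine ⟨hm, aemeasurable_id, ?_⟩
  refine ProbabilityMeasure.tendsto_iff_tendsto_charFun.2 fun t => ?_
  have hmt : ∀ i, Measurable fun s => inner ℝ (X i s) t := fun i => (hX i).inner_const
  have hbt : ∀ s, ‖inner ℝ (X 0 s) t‖ ≤ B * ‖t‖ := fun s =>
    (norm_inner_le_norm _ _).trans (mul_le_mul_of_nonneg_right (hB s) (norm_nonneg _))
  have hL2 : MemLp (fun s => inner ℝ (X 0 s) t) 2 P :=
    MemLp.of_bound (hmt 0).aestronglyMeasurable (B * ‖t‖) (Eventually.of_forall hbt)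
  have hvar : Var[fun s => inner ℝ (X 0 s) t; P] = t ⬝ᵥ C.mulVec t := by
    rw [variance_eq_integral (hmt 0).aemeasurable, ← hcov t, hmean t]
    simp
  have hclt := tendstoInDistribution_inv_sqrt_mul_sum_sub (X := fun i s => inner ℝ (X i s) t)
    (Y := id) (P := P)
    (P' := gaussianReal 0 (Var[fun s => inner ℝ (X 0 s) t; P]).toNNReal) HasLaw.id hL2
    (hindep.comp (fun _ x => inner ℝ x t) fun _ => by fun_prop)
    (fun i => (hident i).comp (u := fun x => inner ℝ x t) (by fun_prop))
  have h1 := ProbabilityMeasure.tendsto_iff_tendsto_charFun.1 hclt.tendsto 1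
  simp only [ProbabilityMeasure.coe_mk, Measure.map_id] at h1 ⊢
  rw [charFun_gaussianReal] at h1
  rw [charFun_multivariateGaussian hC]
  have hlim : Complex.exp (inner ℝ t (0 : EuclideanSpace ℝ (Fin p)) * Complex.I -
      t ⬝ᵥ C.mulVec t / 2) = Complex.exp ((1 : ℝ) * (0 : ℝ) * Complex.I -
      ((Var[fun s => inner ℝ (X 0 s) t; P]).toNNReal : ℝ) * (1 : ℝ) ^ 2 / 2) := by
    rw [Real.coe_toNNReal _ (variance_nonneg _ _), hvar]
    simp
  refine (h1.congr fun n => ?_).trans (le_of_eq ?_)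
  · rw [charFun_apply, charFun_apply, integral_map (hm n) (by fun_prop),
      integral_map (hclt.forall_aemeasurable n) (by fun_prop), hmean t]
    refine integral_congr_ae (Eventually.of_forall fun s => ?_)
    simp [inner_smul_left, sum_inner]
  · rw [hlim]

/-- Slutsky's theorem with a relative error: the error may be proportional to the size of
the sequence whose convergence is to be shown. -/
lemma tendstoInDistribution_of_whp_norm_sub_le [IsProbabilityMeasure P] {E S' : Type*}
    [NormedAddCommGroup E] [InnerProductSpace ℝ E] [FiniteDimensional ℝ E] [MeasurableSpace E]
    [BorelSpace E] [MeasurableSpace S'] {P' : Measure S'} [IsProbabilityMeasure P'] {Z : S' → E}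
    {T W : ℕ → S → E} (hT : ∀ n, AEMeasurable (T n) P)
    (hW : TendstoInDistribution W atTop Z (fun _ => P) P')
    (h : ∀ η > 0, ∀ᶠ x in whp P, ‖T x.1 x.2 - W x.1 x.2‖ ≤ η * (1 + ‖T x.1 x.2‖)) :
    TendstoInDistribution T atTop Z (fun _ => P) P' := by
  refine tendstoInDistribution_of_tendstoInMeasure_sub T Z hW ?_ hT
  have hWm := hW.forall_aemeasurable
  have hprob : ∀ n, IsProbabilityMeasure (P.map (W n)) := fun n =>
    Measure.isProbabilityMeasure_map (hWm n)
  have hprob' : IsProbabilityMeasure (P'.map Z) :=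
    Measure.isProbabilityMeasure_map hW.aemeasurable_limit
  have htight : IsTightMeasureSet (Set.range fun n => P.map (W n)) :=
    isTightMeasureSet_of_tendsto_charFun (f := charFun (P'.map Z)) (by fun_prop)
      (ProbabilityMeasure.tendsto_iff_tendsto_charFun.1 hW.tendsto)
  rw [isTightMeasureSet_iff_exists_isCompact_measure_compl_le] at htight
  rw [tendstoInMeasure_iff_norm]
  intro ε hε
  rw [ENNReal.tendsto_nhds_zero]
  intro ρ hρ
  obtain ⟨K, hK, hKρ⟩ := htight (ρ / 2) (ENNReal.half_pos hρ.ne')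
  obtain ⟨r, hr0, hr⟩ := hK.isBounded.exists_pos_norm_le
  set η : ℝ := min (1 / 2) (ε / (4 * (1 + r))) with hη
  have hη0 : 0 < η := by positivity
  have hη1 : η ≤ 1 / 2 := min_le_left _ _
  have hη2 : η * (4 * (1 + r)) ≤ ε := by
    rw [← le_div_iff₀ (by positivity)]; exact min_le_right _ _
  have hev := ENNReal.tendsto_nhds_zero.1 (eventually_whp.1 (h η hη0)) (ρ / 2)
    (ENNReal.half_pos hρ.ne')
  filter_upwards [hev] with n hn
  have hWK : P {s | W n s ∉ K} ≤ ρ / 2 := by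
    have h1 := hKρ _ ⟨n, rfl⟩
    rwa [Measure.map_apply_of_aemeasurable (hWm n) hK.measurableSet.compl] at h1
  refine (measure_mono fun s hs => ?_).trans ((measure_union_le _ _).trans
    ((add_le_add hn hWK).trans (ENNReal.add_halves ρ).le))
  by_contra hcon
  simp only [Set.mem_union, Set.mem_ofPred_eq, not_or, not_not] at hcon
  simp only [Pi.sub_apply, Pi.zero_apply, sub_zero, Set.mem_ofPred_eq] at hs
  have h1 := hcon.1
  have h2 : ‖T n s‖ ≤ r + ‖T n s - W n s‖ := by
    calc ‖T n s‖ = ‖W n s + (T n s - W n s)‖ := by rw [add_sub_cancel]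
      _ ≤ ‖W n s‖ + ‖T n s - W n s‖ := norm_add_le _ _
      _ ≤ r + ‖T n s - W n s‖ := by gcongr; exact hr _ hcon.2
  -- `d ≤ η (1 + r + d)` with `η ≤ 1 / 2` gives `d ≤ 2 η (1 + r)`.
  have h3 : ‖T n s - W n s‖ ≤ η * (1 + (r + ‖T n s - W n s‖)) := h1.trans (by gcongr)
  nlinarith [norm_nonneg (T n s - W n s)]

end Probability

section Estimator

variable {p : ℕ} {𝓩 : Type*} [MeasurableSpace 𝓩]
  {f : 𝓩 → EuclideanSpace ℝ (Fin p) → ℝ} {f₁ : Fin p → 𝓩 → EuclideanSpace ℝ (Fin p) → ℝ}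
  {f₂ : Fin p → Fin p → 𝓩 → EuclideanSpace ℝ (Fin p) → ℝ}
  {ν : Measure 𝓩} {Θ : Set (EuclideanSpace ℝ (Fin p))} {δ M : ℝ}

/-! ### Perturbation of the likelihood contributions -/

lemma abs_average_le {n : ℕ} {u : ℕ → ℝ} {C : ℝ} (hC : 0 ≤ C) (hu : ∀ i < n, |u i| ≤ C) :
    |(n : ℝ)⁻¹ * ∑ i ∈ Finset.range n, u i| ≤ C := by
  rw [abs_mul, abs_of_nonneg (by positivity : (0 : ℝ) ≤ (n : ℝ)⁻¹)]
  have h1 : |∑ i ∈ Finset.range n, u i| ≤ n * C := by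
    refine (Finset.abs_sum_le_sum_abs _ _).trans ?_
    refine (Finset.sum_le_card_nsmul _ _ C fun i hi => hu i (Finset.mem_range.1 hi)).trans ?_
    simp
  calc (n : ℝ)⁻¹ * |∑ i ∈ Finset.range n, u i| ≤ (n : ℝ)⁻¹ * (n * C) := by gcongr
    _ = (n : ℝ)⁻¹ * n * C := by ring
    _ ≤ 1 * C := by gcongr; exact inv_mul_le_one
    _ = C := one_mul C

lemma abs_log_sub_log_le {x y ε δ : ℝ} (hδ : 0 < δ) (hx : δ < x) (hε : ε ≤ δ / 2)
    (hxy : |x - y| ≤ ε) : |Real.log x - Real.log y| ≤ ε * (2 / δ) := by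
  have hε0 : 0 ≤ ε := (abs_nonneg _).trans hxy
  obtain ⟨h1, h2⟩ := abs_le.1 hxy
  have hy : δ / 2 < y := by linarith
  have hy0 : 0 < y := by linarith
  have hx0 : 0 < x := by linarith
  have key : ∀ a b : ℝ, 0 < a → δ / 2 < b → a - b ≤ ε → Real.log a - Real.log b ≤ ε * (2 / δ) := by
    intro a b ha hb hab
    have hb0 : 0 < b := by linarith
    rw [← Real.log_div ha.ne' hb0.ne']
    refine (Real.log_le_sub_one_of_pos (div_pos ha hb0)).trans ?_
    rw [div_sub_one hb0.ne', div_le_iff₀ hb0]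
    have : ε * (2 / δ) * (δ / 2) = ε := by field_simp
    have h3 := mul_le_mul_of_nonneg_left hb.le (by positivity : 0 ≤ ε * (2 / δ))
    linarith
  rw [abs_le]
  constructor
  · linarith [key y x hy0 (by linarith) (by linarith)]
  · exact key x y hx0 hy h2

/-- An interior maximizer of the average log-likelihood is a zero of its gradient. -/
lemma average_score_eq_zero_of_isMax {𝓨 : Type*} {n : ℕ} {y : ℕ → 𝓨} {a : 𝓨 → EuclideanSpace ℝ (Fin p) → ℝ}
    {a₁ : Fin p → 𝓨 → EuclideanSpace ℝ (Fin p) → ℝ}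
    (hpos : ∀ z, ∀ θ ∈ Θ, 0 < a z θ)
    (hderiv : ∀ z, ∀ θ ∈ interior Θ, HasFDerivAt (a z) (linForm fun k => a₁ k z θ) θ)
    {θ : EuclideanSpace ℝ (Fin p)} (hθ : θ ∈ interior Θ)
    (hmax : ∀ θ' ∈ Θ, (n : ℝ)⁻¹ * ∑ i ∈ Finset.range n, Real.log (a (y i) θ') ≤
      (n : ℝ)⁻¹ * ∑ i ∈ Finset.range n, Real.log (a (y i) θ)) (k : Fin p) :
    (n : ℝ)⁻¹ * ∑ i ∈ Finset.range n, a₁ k (y i) θ / a (y i) θ = 0 := by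
  have h1 := (HasFDerivAt.fun_sum (u := Finset.range n) fun i _ =>
    (hderiv (y i) θ hθ).log (hpos (y i) θ (interior_subset hθ)).ne').const_mul ((n : ℝ)⁻¹)
  simp only [smul_linForm, sum_linForm] at h1
  have hloc : IsLocalMax
      (fun θ' => (n : ℝ)⁻¹ * ∑ i ∈ Finset.range n, Real.log (a (y i) θ')) θ := by
    filter_upwards [isOpen_interior.mem_nhds hθ] with θ' hθ' using hmax θ' (interior_subset hθ')
  have h2 := congrArg (fun l => l (EuclideanSpace.single k (1 : ℝ))) (hloc.hasFDerivAt_eq_zero h1)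
  simp only [linForm_single] at h2
  simpa [div_eq_inv_mul] using h2

namespace RegularFamily

variable (h : RegularFamily ν Θ f f₁ f₂ δ M)

include h

lemma abs_score_sub_le {z : 𝓩} {θ : EuclideanSpace ℝ (Fin p)} (hθ : θ ∈ Θ) {ε a a₁ : ℝ}
    {k : Fin p} (hε : ε ≤ δ / 2) (ha : |f z θ - a| ≤ ε) (ha₁ : |f₁ k z θ - a₁| ≤ ε) :
    |score f f₁ k z θ - a₁ / a| ≤ ε * ((1 + M / δ) * (2 / δ)) := by
  have hδ := h.pos
  have hx := h.lt z θ hθ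
  have hε0 : 0 ≤ ε := (abs_nonneg _).trans ha
  have hy : δ / 2 ≤ a := by linarith [(abs_le.1 ha).2]
  have hy0 : 0 < a := by linarith
  have hx0 : 0 < f z θ := by linarith
  have h1 : score f f₁ k z θ - a₁ / a =
      ((f₁ k z θ - a₁) + score f f₁ k z θ * (a - f z θ)) * a⁻¹ := by
    rw [score]
    field_simp
    ring
  have hinv : a⁻¹ ≤ 2 / δ := by
    rw [inv_eq_one_div, div_le_div_iff₀ hy0 hδ]; linarith
  have hs := h.abs_score_le k z hθ
  have hMδ : 0 ≤ M / δ := (abs_nonneg _).trans hs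
  rw [h1, abs_mul, abs_of_pos (inv_pos.2 hy0)]
  calc |(f₁ k z θ - a₁) + score f f₁ k z θ * (a - f z θ)| * a⁻¹
      ≤ (ε + M / δ * ε) * (2 / δ) := by
        refine mul_le_mul ?_ hinv (inv_pos.2 hy0).le (by positivity)
        refine (abs_add_le _ _).trans (add_le_add ha₁ ?_)
        rw [abs_mul, abs_sub_comm a]
        exact mul_le_mul hs ha (abs_nonneg _) hMδ
    _ = ε * ((1 + M / δ) * (2 / δ)) := by ring

variable {S : Type*} [MeasurableSpace S] {P : Measure S} [IsProbabilityMeasure P]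
  {θ₀ : EuclideanSpace ℝ (Fin p)} {z : ℕ → S → 𝓩}

/-! ### Consistency -/

/-- Near-maximizers of the sample log-likelihood are consistent: a point whose approximate
log-likelihood is maximal has nearly maximal expected log-likelihood, by the uniform law of large
numbers, and by the information inequality and compactness it is then close to `θ₀`. -/
lemma consistency (hθ₀ : θ₀ ∈ Θ)
    (hident : ∀ θ ∈ Θ, θ ≠ θ₀ → ¬ (fun z => f z θ) =ᵐ[ν] fun z => f z θ₀)
    (hz_meas : ∀ i, Measurable (z i)) (hz_indep : iIndepFun z P)
    (hz_law : ∀ i, P.map (z i) = law f ν θ₀) {a : ℕ → S → 𝓩 → EuclideanSpace ℝ (Fin p) → ℝ}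
    (ha : ∀ ε > 0, ∀ᶠ x in whp P, ∀ z, ∀ θ ∈ Θ, |f z θ - a x.1 x.2 z θ| ≤ ε)
    {θhat : ℕ → S → EuclideanSpace ℝ (Fin p)}
    (hmax : ∀ᶠ x in whp P, θhat x.1 x.2 ∈ Θ ∧ ∀ θ ∈ Θ,
      (x.1 : ℝ)⁻¹ * ∑ i ∈ Finset.range x.1, Real.log (a x.1 x.2 (z i x.2) θ) ≤
        (x.1 : ℝ)⁻¹ * ∑ i ∈ Finset.range x.1, Real.log (a x.1 x.2 (z i x.2) (θhat x.1 x.2)))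
    {ρ : ℝ} (hρ : 0 < ρ) : ∀ᶠ x in whp P, θhat x.1 x.2 ∈ Metric.ball θ₀ ρ := by
  have hδ := h.pos
  obtain ⟨hcont, hlln⟩ := uniform_law_of_large_numbers h.isCompact hz_meas hz_indep hz_law
    (g := fun z θ => Real.log (f z θ)) (fun θ hθ => (h.measurable θ hθ).log)
    h.continuousOn_log fun z θ hθ => h.abs_log_le z hθ
  set L : EuclideanSpace ℝ (Fin p) → ℝ := fun θ => ∫ z, Real.log (f z θ) ∂(law f ν θ₀) with hL
  -- The expected log-likelihood is bounded away from its maximum outside the ball.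
  obtain ⟨γ, hγ, hsep⟩ : ∃ γ > 0, ∀ θ ∈ Θ \ Metric.ball θ₀ ρ, L θ + γ ≤ L θ₀ := by
    have hKc : IsCompact (Θ \ Metric.ball θ₀ ρ) := h.isCompact.diff Metric.isOpen_ball
    obtain hK | hK := (Θ \ Metric.ball θ₀ ρ).eq_empty_or_nonempty
    · exact ⟨1, one_pos, by simp [hK]⟩
    obtain ⟨θ₁, hθ₁, hmax₁⟩ := hKc.exists_isMaxOn hK (hcont.mono Set.sdiff_subset)
    have hne : θ₁ ≠ θ₀ := fun h0 => hθ₁.2 (h0 ▸ Metric.mem_ball_self hρ)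
    refine ⟨L θ₀ - L θ₁, sub_pos.2 (h.integral_log_lt hθ₁.1 hθ₀ (hident _ hθ₁.1 hne)),
      fun θ hθ => ?_⟩
    have := hmax₁ hθ
    simp only [Set.mem_ofPred_eq] at this
    linarith
  set ε : ℝ := min (δ / 2) (γ / 8 * (δ / 2)) with hε
  have hε0 : 0 < ε := by positivity
  have hεγ : ε * (2 / δ) ≤ γ / 8 := by
    calc ε * (2 / δ) ≤ γ / 8 * (δ / 2) * (2 / δ) := by gcongr; exact min_le_right _ _
      _ = γ / 8 := by field_simp
  filter_upwards [ha ε hε0, hmax, hlln (γ / 8) (by positivity)] with x hx1 hx2 hx3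
  have hdiff : ∀ θ ∈ Θ,
      |(x.1 : ℝ)⁻¹ * ∑ i ∈ Finset.range x.1, Real.log (f (z i x.2) θ) -
        (x.1 : ℝ)⁻¹ * ∑ i ∈ Finset.range x.1, Real.log (a x.1 x.2 (z i x.2) θ)| ≤ γ / 8 := by
    intro θ hθ
    rw [← mul_sub, ← Finset.sum_sub_distrib]
    exact abs_average_le (by positivity) fun i _ => (abs_log_sub_log_le hδ (h.lt _ θ hθ)
      (min_le_left _ _) (hx1 _ θ hθ)).trans hεγ
  by_contra hball
  have h1 := hsep _ ⟨hx2.1, hball⟩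
  have h2 := hx2.2 θ₀ hθ₀
  have h3 := abs_le.1 (hdiff θ₀ hθ₀)
  have h4 := abs_le.1 (hdiff _ hx2.1)
  have h5 := abs_lt.1 (hx3 θ₀ hθ₀)
  have h6 := abs_lt.1 (hx3 _ hx2.1)
  change -(γ / 8) < _ - L θ₀ ∧ _ - L θ₀ < _ at h5
  change -(γ / 8) < _ - L (θhat x.1 x.2) ∧ _ - L (θhat x.1 x.2) < _ at h6
  linarith [h3.1, h3.2, h4.1, h4.2, h5.1, h5.2, h6.1, h6.2]

/-! ### Asymptotic linearity of the estimator -/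

/-- The average score is approximately linear near `θ₀`, with slope minus the Fisher information:
by the uniform law of large numbers its derivative is uniformly close to the expected
Hessian, which is continuous. -/
lemma score_expansion (hθ₀ : θ₀ ∈ interior Θ) (hz_meas : ∀ i, Measurable (z i))
    (hz_indep : iIndepFun z P) (hz_law : ∀ i, P.map (z i) = law f ν θ₀) {η : ℝ} (hη : 0 < η) :
    ∃ ρ > 0, ∀ᶠ x in whp P, ∀ θ ∈ Metric.ball θ₀ ρ, ∀ k : Fin p,
      |(x.1 : ℝ)⁻¹ * ∑ i ∈ Finset.range x.1, score f f₁ k (z i x.2) θ -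
        (x.1 : ℝ)⁻¹ * ∑ i ∈ Finset.range x.1, score f f₁ k (z i x.2) θ₀ +
        ∑ j, fisherInformation (law f ν θ₀) f θ₀ j k * (θ - θ₀) j| ≤ η * ‖θ - θ₀‖ := by
  set J := fisherInformation (law f ν θ₀) f θ₀ with hJ
  obtain ⟨r, hr, hrΘ⟩ := Metric.nhds_basis_closedBall.mem_iff.1 (isOpen_interior.mem_nhds hθ₀)
  have hulln := fun k i : Fin p => uniform_law_of_large_numbers
    (isCompact_closedBall θ₀ r) hz_meas hz_indep hz_law (g := hess f f₁ f₂ k i)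
    (fun θ hθ => h.measurable_hess k i (hrΘ hθ))
    (fun z => (h.continuousOn_hess k i z).mono (hrΘ.trans interior_subset))
    (fun z θ hθ => h.abs_hess_le k i z (interior_subset (hrΘ hθ)))
  set η' : ℝ := η / (2 * (p + 1)) with hη'
  have hη'0 : 0 < η' := by positivity
  have hη'1 : p * (η' + η') ≤ η := by
    rw [hη']
    have : (p : ℝ) * (η / (2 * (p + 1)) + η / (2 * (p + 1))) = η * (p / (p + 1)) := by
      field_simp
      ring
    rw [this]
    refine mul_le_of_le_one_right hη.le ?_
    rw [div_le_one (by positivity)]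
    linarith
  have hnear : ∀ᶠ θ in 𝓝 θ₀, ∀ k i : Fin p,
      |∫ z, hess f f₁ f₂ k i z θ ∂(law f ν θ₀) + J k i| < η' := by
    refine eventually_all.2 fun k => eventually_all.2 fun i => ?_
    have hc := (hulln k i).1.continuousAt (Metric.closedBall_mem_nhds θ₀ hr)
    have hc' := (hc.add_const (J k i)).abs
    refine hc'.eventually_lt_const ?_
    have h0 : |∫ z, hess f f₁ f₂ k i z θ₀ ∂(law f ν θ₀) + J k i| = 0 := by
      rw [h.integral_hess k i hθ₀, ← hJ, neg_add_cancel, abs_zero]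
    exact h0.trans_lt hη'0
  obtain ⟨ρ', hρ', hball⟩ := Metric.eventually_nhds_iff_ball.1 hnear
  have hev : ∀ᶠ x in whp P, ∀ k i : Fin p, ∀ θ ∈ Metric.closedBall θ₀ r,
      |(x.1 : ℝ)⁻¹ * ∑ l ∈ Finset.range x.1, hess f f₁ f₂ k i (z l x.2) θ -
        ∫ z, hess f f₁ f₂ k i z θ ∂(law f ν θ₀)| < η' :=
    eventually_all.2 fun k => eventually_all.2 fun i => (hulln k i).2 η' hη'0
  refine ⟨min r ρ', lt_min hr hρ', ?_⟩
  filter_upwards [hev] with x hx θ hθ k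
  set Φ : EuclideanSpace ℝ (Fin p) → ℝ := fun θ =>
    (x.1 : ℝ)⁻¹ * ∑ i ∈ Finset.range x.1, score f f₁ k (z i x.2) θ +
      linForm (fun j => J j k) θ with hΦ
  have hsub1 : Metric.ball θ₀ (min r ρ') ⊆ Metric.closedBall θ₀ r :=
    (Metric.ball_subset_ball (min_le_left _ _)).trans Metric.ball_subset_closedBall
  have hsub2 : Metric.ball θ₀ (min r ρ') ⊆ Metric.ball θ₀ ρ' :=
    Metric.ball_subset_ball (min_le_right _ _)
  have hderiv : ∀ θ ∈ Metric.ball θ₀ (min r ρ'), HasFDerivAt Φ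
      (linForm fun j => (x.1 : ℝ)⁻¹ * ∑ i ∈ Finset.range x.1, hess f f₁ f₂ j k (z i x.2) θ +
        J j k) θ := by
    intro θ hθ
    have h1 := HasFDerivAt.fun_sum (u := Finset.range x.1)
      fun i _ => h.hasFDerivAt_score k (z i x.2) (hrΘ (hsub1 hθ))
    have h2 := (h1.const_mul ((x.1 : ℝ)⁻¹)).add (linForm fun j => J j k).hasFDerivAt
    rw [sum_linForm, smul_linForm, linForm_add] at h2
    exact h2
  have hbound : ∀ θ ∈ Metric.ball θ₀ (min r ρ'),
      ‖linForm fun j => (x.1 : ℝ)⁻¹ * ∑ i ∈ Finset.range x.1, hess f f₁ f₂ j k (z i x.2) θ +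
        J j k‖ ≤ η := by
    intro θ hθ
    refine (norm_linForm_le _ fun j => ?_).trans hη'1
    have h1 := (hx j k θ (hsub1 hθ)).le
    have h2 := (hball θ (hsub2 hθ) j k).le
    refine le_trans ?_ (add_le_add h1 h2)
    refine le_trans (le_of_eq ?_) (abs_add_le _ _)
    congr 1
    ring
  have hmv := (convex_ball θ₀ (min r ρ')).norm_image_sub_le_of_norm_hasFDerivWithin_le
    (fun θ hθ => (hderiv θ hθ).hasFDerivWithinAt) hbound
    (Metric.mem_ball_self (lt_min hr hρ')) hθ
  refine le_trans (le_of_eq ?_) hmv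
  rw [Real.norm_eq_abs]
  congr 1
  have h3 : linForm (fun j => J j k) (θ - θ₀) = ∑ j, J j k * (θ - θ₀) j := linForm_apply _ _
  rw [map_sub] at h3
  simp only [hΦ]
  linarith

/-- The Fisher information is the covariance matrix of the score. -/
lemma integral_sum_score_sq (hθ₀ : θ₀ ∈ interior Θ) (c : Fin p → ℝ) :
    ∫ z, (∑ k, c k * score f f₁ k z θ₀) ^ 2 ∂(law f ν θ₀) =
      c ⬝ᵥ (fisherInformation (law f ν θ₀) f θ₀).mulVec c := by
  have := h.isProbabilityMeasure_law (interior_subset hθ₀)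
  have h1 : ∀ z, (∑ k, c k * score f f₁ k z θ₀) ^ 2 =
      ∑ k, ∑ j, c k * (c j * (score f f₁ k z θ₀ * score f f₁ j z θ₀)) := fun z => by
    rw [sq, Finset.sum_mul_sum]
    refine Finset.sum_congr rfl fun k _ => Finset.sum_congr rfl fun j _ => by ring
  simp_rw [h1]
  have hi : ∀ k j, Integrable
      (fun z => c k * (c j * (score f f₁ k z θ₀ * score f f₁ j z θ₀))) (law f ν θ₀) := fun k j =>
    ((h.integrable_score_mul k j hθ₀).const_mul _).const_mul _
  rw [integral_finsetSum _ fun k _ => integrable_finsetSum _ fun j _ => hi k j]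
  simp only [dotProduct, Matrix.mulVec, Finset.mul_sum]
  refine Finset.sum_congr rfl fun k _ => ?_
  rw [integral_finsetSum _ fun j _ => hi k j]
  refine Finset.sum_congr rfl fun j _ => ?_
  rw [integral_const_mul, integral_const_mul, h.fisherInformation_apply hθ₀]
  ring

lemma posSemidef_fisherInformation (hθ₀ : θ₀ ∈ interior Θ) :
    (fisherInformation (law f ν θ₀) f θ₀).PosSemidef := by
  refine Matrix.PosSemidef.of_dotProduct_mulVec_nonneg ?_ fun c => ?_
  · ext i j
    simp only [Matrix.conjTranspose_apply, star_trivial, h.fisherInformation_apply hθ₀, mul_comm]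
  · rw [star_trivial, ← h.integral_sum_score_sq hθ₀ c]
    exact integral_nonneg fun z => sq_nonneg _

/-- Asymptotic normality of a maximizer of approximate log-likelihoods whose contributions and their
gradients have errors `o_P(n^{-1/2})`, uniformly over the data space and the parameter set. -/
theorem asymptotic_normality (hθ₀ : θ₀ ∈ interior Θ)
    (hident : ∀ θ ∈ Θ, θ ≠ θ₀ → ¬ (fun z => f z θ) =ᵐ[ν] fun z => f z θ₀)
    (hJ : IsUnit (fisherInformation (law f ν θ₀) f θ₀).det)
    (hz_meas : ∀ i, Measurable (z i)) (hz_indep : iIndepFun z P)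
    (hz_law : ∀ i, P.map (z i) = law f ν θ₀) {a : ℕ → S → 𝓩 → EuclideanSpace ℝ (Fin p) → ℝ}
    {a₁ : ℕ → S → Fin p → 𝓩 → EuclideanSpace ℝ (Fin p) → ℝ}
    (hderiv : ∀ n s z, ∀ θ ∈ interior Θ,
      HasFDerivAt (a n s z) (linForm fun k => a₁ n s k z θ) θ)
    (ha : ∀ ε > 0, ∀ᶠ x in whp P, ∀ z, ∀ θ ∈ Θ, |f z θ - a x.1 x.2 z θ| ≤ ε / Real.sqrt x.1 ∧
      ∀ k, |f₁ k z θ - a₁ x.1 x.2 k z θ| ≤ ε / Real.sqrt x.1)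
    {θhat : ℕ → S → EuclideanSpace ℝ (Fin p)} (hθhat_meas : ∀ n, AEMeasurable (θhat n) P)
    (hmax : ∀ᶠ x in whp P, (∀ i < x.1, ∀ θ ∈ Θ, 0 < a x.1 x.2 (z i x.2) θ) →
      θhat x.1 x.2 ∈ Θ ∧ ∀ θ ∈ Θ,
      (x.1 : ℝ)⁻¹ * ∑ i ∈ Finset.range x.1, Real.log (a x.1 x.2 (z i x.2) θ) ≤
        (x.1 : ℝ)⁻¹ * ∑ i ∈ Finset.range x.1, Real.log (a x.1 x.2 (z i x.2) (θhat x.1 x.2))) :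
    TendstoInDistribution (fun (n : ℕ) s => Real.sqrt n • (θhat n s - θ₀)) atTop id (fun _ => P)
      (multivariateGaussian 0 (fisherInformation (law f ν θ₀) f θ₀)⁻¹) := by
  have hδ := h.pos
  have hθ₀' := interior_subset hθ₀
  set J := fisherInformation (law f ν θ₀) f θ₀ with hJdef
  have hJpsd : J.PosSemidef := h.posSemidef_fisherInformation hθ₀
  have hn1 : ∀ᶠ x in whp P, 1 ≤ x.1 := eventually_whp_of_eventually (eventually_ge_atTop 1)
  have hunif : ∀ ε > 0, ∀ᶠ x in whp P, ∀ z, ∀ θ ∈ Θ, |f z θ - a x.1 x.2 z θ| ≤ ε := by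
    intro ε hε
    filter_upwards [ha ε hε, hn1] with x hx hx1 z θ hθ
    refine (hx z θ hθ).1.trans (div_le_self hε.le ?_)
    rw [Real.one_le_sqrt]
    exact_mod_cast hx1
  have hpos : ∀ᶠ x in whp P, ∀ z, ∀ θ ∈ Θ, 0 < a x.1 x.2 z θ := by
    filter_upwards [hunif δ hδ] with x hx z θ hθ
    linarith [(abs_le.1 (hx z θ hθ)).2, h.lt z θ hθ]
  have hmax' : ∀ᶠ x in whp P, θhat x.1 x.2 ∈ Θ ∧ ∀ θ ∈ Θ,
      (x.1 : ℝ)⁻¹ * ∑ i ∈ Finset.range x.1, Real.log (a x.1 x.2 (z i x.2) θ) ≤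
        (x.1 : ℝ)⁻¹ * ∑ i ∈ Finset.range x.1,
          Real.log (a x.1 x.2 (z i x.2) (θhat x.1 x.2)) := by
    filter_upwards [hpos, hmax] with x hx1 hx2 using hx2 fun i _ => hx1 _
  -- The approximately linear part of the estimator.
  set X : ℕ → S → EuclideanSpace ℝ (Fin p) := fun i s =>
    WithLp.toLp 2 (J⁻¹.mulVec fun k => score f f₁ k (z i s) θ₀) with hX
  set A : ℝ := ∑ l, ∑ k, |J⁻¹ l k| with hA
  have hA0 : 0 ≤ A := Finset.sum_nonneg fun l _ => Finset.sum_nonneg fun k _ => abs_nonneg _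
  have hmulVec : ∀ (u : Fin p → ℝ) (B : ℝ), (∀ k, |u k| ≤ B) →
      ‖(WithLp.toLp 2 (J⁻¹.mulVec u) : EuclideanSpace ℝ (Fin p))‖ ≤ A * B := by
    intro u B hu
    refine (norm_le_sum_abs _).trans ?_
    rw [hA, Finset.sum_mul]
    refine Finset.sum_le_sum fun l _ => ?_
    rw [Finset.sum_mul]
    simp only [Matrix.mulVec, dotProduct]
    refine (Finset.abs_sum_le_sum_abs _ _).trans (Finset.sum_le_sum fun k _ => ?_)
    rw [abs_mul]
    exact mul_le_mul_of_nonneg_left (hu k) (abs_nonneg _)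
  have hclt : TendstoInDistribution
      (fun (n : ℕ) s => (Real.sqrt n)⁻¹ • ∑ i ∈ Finset.range n, X i s) atTop id
      (fun _ => P) (multivariateGaussian 0 J⁻¹) := by
    set Y : 𝓩 → EuclideanSpace ℝ (Fin p) := fun z =>
      WithLp.toLp 2 (J⁻¹.mulVec fun k => score f f₁ k z θ₀) with hY
    have hYm : Measurable Y := by
      refine (PiLp.continuous_toLp 2 fun _ : Fin p => ℝ).measurable.comp
        (measurable_pi_lambda _ fun l => ?_)
      simp only [Matrix.mulVec, dotProduct]
      exact Finset.measurable_fun_sum _ fun k _ => (h.measurable_score k hθ₀).const_mul _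
    have hXm : ∀ i, Measurable (X i) := fun i => hYm.comp (hz_meas i)
    -- The projection of `J⁻¹ s` on `t` is the projection of the score `s` on `J⁻¹ t`.
    have hinner : ∀ (t : EuclideanSpace ℝ (Fin p)) z,
        inner ℝ (Y z) t = ∑ k, Matrix.vecMul t J⁻¹ k * score f f₁ k z θ₀ := by
      intro t z
      have h1 : inner ℝ (Y z) t = (t : Fin p → ℝ) ⬝ᵥ J⁻¹.mulVec fun k => score f f₁ k z θ₀ := by
        simp [hY, PiLp.inner_apply, dotProduct]
      rw [h1, Matrix.dotProduct_mulVec]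
      rfl
    have hint : ∀ (t : EuclideanSpace ℝ (Fin p)) (m : ℕ), ∫ s, inner ℝ (X 0 s) t ^ m ∂P =
        ∫ z, (∑ k, Matrix.vecMul t J⁻¹ k * score f f₁ k z θ₀) ^ m ∂(law f ν θ₀) := by
      intro t m
      rw [← hz_law 0, integral_map (hz_meas 0).aemeasurable]
      · exact integral_congr_ae (Eventually.of_forall fun s => congrArg (· ^ m) (hinner t (z 0 s)))
      · exact ((Finset.measurable_fun_sum _ fun k _ =>
          (h.measurable_score k hθ₀).const_mul _).pow_const m).aestronglyMeasurable
    have := h.isProbabilityMeasure_law hθ₀'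
    have hz_ident : ∀ i, IdentDistrib (z i) (z 0) P P := fun i =>
      ⟨(hz_meas i).aemeasurable, (hz_meas 0).aemeasurable, by rw [hz_law, hz_law]⟩
    refine tendstoInDistribution_multivariateGaussian (B := A * (M / δ)) hXm
      (hz_indep.comp (fun _ => Y) fun _ => hYm)
      (fun i => (hz_ident i).comp hYm)
      (fun s => hmulVec _ _ fun k => h.abs_score_le k _ hθ₀') hJpsd.inv ?_ ?_
    · intro t
      have h1 := hint t 1
      simp only [pow_one] at h1
      rw [h1, integral_finsetSum _ fun k _ => (h.integrable_score k hθ₀).const_mul _]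
      refine Finset.sum_eq_zero fun k _ => ?_
      rw [integral_const_mul, h.integral_score k hθ₀, mul_zero]
    · intro t
      have hsymm : Matrix.transpose J⁻¹ = J⁻¹ := by
        rw [← Matrix.conjTranspose_eq_transpose_of_trivial]
        exact hJpsd.inv.isHermitian
      rw [hint t 2, h.integral_sum_score_sq hθ₀, ← hJdef]
      have h1 : Matrix.vecMul t J⁻¹ = J⁻¹.mulVec t := by
        conv_lhs => rw [← hsymm, Matrix.vecMul_transpose]
      rw [h1, Matrix.mulVec_mulVec, Matrix.mul_nonsing_inv _ hJ, Matrix.one_mulVec, dotProduct_comm]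
  refine tendstoInDistribution_of_whp_norm_sub_le
    (fun n => ((hθhat_meas n).sub_const θ₀).const_smul (Real.sqrt n)) hclt fun η hη => ?_
  set η' : ℝ := η / (A + 1) with hη'
  have hη'0 : 0 < η' := by positivity
  have hη'A : A * η' ≤ η := by
    rw [hη', mul_div_assoc', div_le_iff₀ (by positivity)]
    nlinarith
  obtain ⟨ρ, hρ, hexp⟩ := h.score_expansion hθ₀ hz_meas hz_indep hz_law hη'0
  obtain ⟨r, hr, hrΘ⟩ := Metric.isOpen_iff.1 isOpen_interior θ₀ hθ₀
  have hcons := h.consistency hθ₀' hident hz_meas hz_indep hz_law hunif hmax' (lt_min hρ hr)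
  have hMδ : 0 ≤ 1 + M / δ := by
    have hM : 0 ≤ M / δ := by
      have hne : Nonempty 𝓩 := by
        by_contra hemp
        rw [not_nonempty_iff] at hemp
        simpa using h.lintegral θ₀ hθ₀'
      exact div_nonneg ((abs_nonneg _).trans (h.bound hne.some θ₀ hθ₀')) hδ.le
    linarith
  set D : ℝ := (1 + M / δ) * (2 / δ) with hD
  have hD0 : 0 ≤ D := by positivity
  set ε : ℝ := min (δ / 2) (η' / (D + 1)) with hε
  have hε0 : 0 < ε := by positivity
  have hεD : ε * D ≤ η' := by
    have h1 : ε * (D + 1) ≤ η' := by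
      rw [← le_div_iff₀ (by positivity)]; exact min_le_right _ _
    nlinarith
  filter_upwards [hn1, ha ε hε0, hpos, hmax', hexp, hcons] with x hx1 hxa hxpos hxmax hxexp hxcons
  obtain ⟨n, s⟩ := x
  simp only at hx1 hxa hxpos hxmax hxexp hxcons ⊢
  set τ : EuclideanSpace ℝ (Fin p) := θhat n s with hτ
  have hsq : 1 ≤ Real.sqrt n := by
    rw [Real.one_le_sqrt]; exact_mod_cast hx1
  have hsq0 : 0 < Real.sqrt n := by linarith
  have hτint : τ ∈ interior Θ := hrΘ (Metric.ball_subset_ball (min_le_right _ _) hxcons)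
  have hτρ : τ ∈ Metric.ball θ₀ ρ := Metric.ball_subset_ball (min_le_left _ _) hxcons
  have hεn : ε / Real.sqrt n ≤ δ / 2 := (div_le_self hε0.le hsq).trans (min_le_left _ _)
  -- At the estimator the approximate score vanishes, so the exact average score is at most
  -- `η' / √n` in absolute value.
  have hscore : ∀ k, |(n : ℝ)⁻¹ * ∑ i ∈ Finset.range n, score f f₁ k (z i s) τ| ≤
      ε / Real.sqrt n * D := by
    intro k
    have h0 := average_score_eq_zero_of_isMax (n := n) (y := fun i => z i s) hxpos (hderiv n s) hτint
      hxmax.2 k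
    have h1 : (n : ℝ)⁻¹ * ∑ i ∈ Finset.range n, score f f₁ k (z i s) τ =
        (n : ℝ)⁻¹ * ∑ i ∈ Finset.range n, (score f f₁ k (z i s) τ -
          a₁ n s k (z i s) τ / a n s (z i s) τ) := by
      rw [Finset.sum_sub_distrib, mul_sub, h0, sub_zero]
    rw [h1]
    exact abs_average_le (by positivity) fun i _ => h.abs_score_sub_le (interior_subset hτint) hεn
      (hxa _ τ (interior_subset hτint)).1 ((hxa _ τ (interior_subset hτint)).2 k)
  set T : EuclideanSpace ℝ (Fin p) := Real.sqrt n • (τ - θ₀) with hT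
  set u : Fin p → ℝ := fun k => J.mulVec T k -
    (Real.sqrt n)⁻¹ * ∑ i ∈ Finset.range n, score f f₁ k (z i s) θ₀ with hu
  have hTW : T - (Real.sqrt n)⁻¹ • ∑ i ∈ Finset.range n, X i s = WithLp.toLp 2 (J⁻¹.mulVec u) := by
    have h1 : u = J.mulVec T - (Real.sqrt n)⁻¹ • ∑ i ∈ Finset.range n,
        fun k => score f f₁ k (z i s) θ₀ := by
      ext k; simp [hu]
    rw [h1, Matrix.mulVec_sub, Matrix.mulVec_mulVec, Matrix.nonsing_inv_mul _ hJ,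
      Matrix.one_mulVec, Matrix.mulVec_smul, Matrix.mulVec_sum]
    ext l
    simp [hX]
  have hTnorm : ‖T‖ = Real.sqrt n * ‖τ - θ₀‖ := by
    rw [hT, norm_smul, Real.norm_eq_abs, abs_of_pos hsq0]
  have hubound : ∀ k, |u k| ≤ η' * (1 + ‖T‖) := by
    intro k
    have h1 := hxexp τ hτρ k
    have h2 := hscore k
    have hinv : Real.sqrt n * (n : ℝ)⁻¹ = (Real.sqrt n)⁻¹ := by
      rw [← div_eq_mul_inv, Real.sqrt_div_self', one_div]
    have hJT : J.mulVec T k = Real.sqrt n * ∑ j, J j k * (τ - θ₀) j := by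
      have hs : ∀ j, J k j = J j k := fun j => by
        have := congrFun (congrFun hJpsd.isHermitian k) j
        simpa using this.symm
      simp only [Matrix.mulVec, dotProduct, Finset.mul_sum, hT, PiLp.smul_apply, smul_eq_mul]
      exact Finset.sum_congr rfl fun j _ => by rw [hs]; ring
    have hdecomp : u k = Real.sqrt n * ((n : ℝ)⁻¹ * ∑ i ∈ Finset.range n,
        score f f₁ k (z i s) τ - (n : ℝ)⁻¹ * ∑ i ∈ Finset.range n, score f f₁ k (z i s) θ₀ +
        ∑ j, J j k * (τ - θ₀) j) -
        Real.sqrt n * ((n : ℝ)⁻¹ * ∑ i ∈ Finset.range n, score f f₁ k (z i s) τ) := by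
      simp only [hu, hJT, ← hinv]
      ring
    rw [hdecomp]
    refine (abs_sub _ _).trans ?_
    rw [abs_mul, abs_mul, abs_of_pos hsq0, mul_add, mul_one, hTnorm, add_comm]
    refine add_le_add ?_ ?_
    · calc _ ≤ Real.sqrt n * (ε / Real.sqrt n * D) := mul_le_mul_of_nonneg_left h2 hsq0.le
        _ = ε * D := by field_simp
        _ ≤ η' := hεD
    · calc _ ≤ Real.sqrt n * (η' * ‖τ - θ₀‖) := mul_le_mul_of_nonneg_left h1 hsq0.le
        _ = η' * (Real.sqrt n * ‖τ - θ₀‖) := by ring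
  rw [hTW]
  calc _ ≤ A * (η' * (1 + ‖T‖)) := hmulVec u _ hubound
    _ = A * η' * (1 + ‖T‖) := by ring
    _ ≤ η * (1 + ‖T‖) := by gcongr

end RegularFamily

end Estimator

/-! ### The maximum approximated likelihood estimator -/

/-- A random cubature rule whose error tends to zero in probability has realizations of arbitrarily
small error. -/
lemma exists_cubatureError_le {S : Type*} [MeasurableSpace S] {P : Measure S}
    [IsProbabilityMeasure P] {X : ℕ → S → ℝ≥0∞} (h : TendstoZeroInProbability P X) {ε : ℝ}
    (hε : 0 < ε) : ∃ r s, X r s ≤ ENNReal.ofReal ε := by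
  have h1 := (h (ENNReal.ofReal ε) (ENNReal.ofReal_pos.2 hε)).eventually_lt_const zero_lt_one
  obtain ⟨r, hr⟩ := h1.exists
  by_contra hcon
  push Not at hcon
  refine hr.ne ?_
  rw [← measure_univ (μ := P)]
  congr 1
  exact Set.eq_univ_of_forall fun s => (hcon r s).le

/-- A bound on the error after scaling by `√n`, as a bound on the error itself. -/
lemma le_ofReal_div_sqrt {n : ℕ} (hn : 1 ≤ n) {e : ℝ≥0∞} {ε : ℝ}
    (h : ENNReal.ofReal (Real.sqrt n) * e ≤ ENNReal.ofReal ε) :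
    e ≤ ENNReal.ofReal (ε / Real.sqrt n) := by
  have hn0 : 0 < Real.sqrt n := Real.sqrt_pos.2 (by exact_mod_cast hn)
  rw [ENNReal.ofReal_div_of_pos hn0, ENNReal.le_div_iff_mul_le
    (Or.inl (by simpa using hn0)) (Or.inl ENNReal.ofReal_ne_top), mul_comm]
  exact h

end MALE

theorem corollary11 {d p : ℕ}
    -- the sample space, with a dominating measure `ν`
    {𝓩 : Type*} [MeasurableSpace 𝓩] (ν : Measure 𝓩)
    -- the domain of integration, the weight function, the integrand
    (Ω : Set (EuclideanSpace ℝ (Fin d))) (hΩ : MeasurableSet Ω)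
    (ω : EuclideanSpace ℝ (Fin d) → ℝ) (hω : ∀ v ∈ Ω, 0 ≤ ω v)
    (φ : EuclideanSpace ℝ (Fin d) → 𝓩 → EuclideanSpace ℝ (Fin p) → ℝ)
    -- the parameter set and the true parameter, an interior point
    (Θ : Set (EuclideanSpace ℝ (Fin p))) (hΘ : IsCompact Θ)
    (θ₀ : EuclideanSpace ℝ (Fin p)) (hθ₀ : θ₀ ∈ interior Θ)
    -- the functions `f(·, θ)` are probability densities
    (hf_meas : ∀ θ ∈ Θ, Measurable fun z => MALE.likelihood Ω ω φ z θ)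
    (hf_density : ∀ θ ∈ Θ, ∫⁻ z, ENNReal.ofReal (MALE.likelihood Ω ω φ z θ) ∂ν = 1)
    -- identification
    (hf_ident : ∀ θ ∈ Θ, θ ≠ θ₀ →
      ¬ ((fun z => MALE.likelihood Ω ω φ z θ) =ᵐ[ν] fun z => MALE.likelihood Ω ω φ z θ₀))
    -- the likelihood contributions are bounded away from zero
    (hf_pos : ∃ δ : ℝ, 0 < δ ∧ ∀ z, ∀ θ ∈ Θ, δ < MALE.likelihood Ω ω φ z θ)
    -- `φ(v, z, ·)` is twice continuously differentiable
    (hφ : ∀ v ∈ Ω, ∀ z, ∀ θ ∈ Θ, ContDiffAt ℝ 2 (φ v z) θ)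
    -- the integrals of the derivatives of order at most two exist and are bounded
    (hφ_int : ∀ m ≤ 2, ∀ (i : Fin m → Fin p) (z : 𝓩), ∀ θ ∈ Θ,
      IntegrableOn (fun v => MALE.partialD i (φ v z) θ * ω v) Ω)
    (hφ_bdd : ∃ M : ℝ, ∀ m ≤ 2, ∀ (i : Fin m → Fin p) (z : 𝓩), ∀ θ ∈ Θ,
      |∫ v in Ω, MALE.partialD i (φ v z) θ * ω v| ≤ M)
    -- the Fisher information matrix is nonsingular
    (h_fisher : IsUnit (MALE.fisherInformation
      (ν.withDensity fun z => ENNReal.ofReal (MALE.likelihood Ω ω φ z θ₀))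
      (MALE.likelihood Ω ω φ) θ₀).det)
    -- an i.i.d. sample with density `f(·, θ₀)`
    {S : Type*} [MeasurableSpace S] (P : Measure S) [IsProbabilityMeasure P]
    (z : ℕ → S → 𝓩) (hz_meas : ∀ i, Measurable (z i)) (hz_indep : iIndepFun z P)
    (hz_law : ∀ i, P.map (z i) =
      ν.withDensity fun z => ENNReal.ofReal (MALE.likelihood Ω ω φ z θ₀))
    -- the cubature rules, possibly random
    (U : S → (r : ℕ) → MALE.CubatureRule d r) (hU : ∀ s r j, (U s r).node j ∈ Ω)
    (hE₂ : MALE.TendstoZeroInProbability P fun r s => MALE.cubatureError Ω ω φ Θ 2 (U s r))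
    -- the link between sample size and number of nodes
    (R : ℕ → ℕ) (hR_mono : Monotone R) (hR_lim : Tendsto R atTop atTop)
    (hE₁ : MALE.TendstoZeroInProbability P fun n s =>
      ENNReal.ofReal (Real.sqrt n) * MALE.cubatureError Ω ω φ Θ 1 (U s (R n)))
    -- the estimator: it maximizes the approximated log-likelihood wherever that is well defined
    (θhat : ℕ → S → EuclideanSpace ℝ (Fin p)) (hθhat_meas : ∀ n, AEMeasurable (θhat n) P)
    (hθhat : ∀ n, ∀ᵐ s ∂P,
      (∀ i < n, ∀ θ ∈ Θ, 0 < MALE.approxLikelihood φ (U s (R n)) (z i s) θ) →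
        θhat n s ∈ Θ ∧ ∀ θ ∈ Θ,
          MALE.approxLogLikelihood φ (U s (R n)) n (fun i => z i s) θ ≤
            MALE.approxLogLikelihood φ (U s (R n)) n (fun i => z i s) (θhat n s)) :
    TendstoInDistribution (fun (n : ℕ) s => Real.sqrt n • (θhat n s - θ₀)) atTop id (fun _ => P)
      (multivariateGaussian 0 (MALE.fisherInformation
        (ν.withDensity fun z => ENNReal.ofReal (MALE.likelihood Ω ω φ z θ₀))
        (MALE.likelihood Ω ω φ) θ₀)⁻¹) := by
  obtain ⟨δ, hδ, hf_lt⟩ := hf_pos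
  obtain ⟨M, hM⟩ := hφ_bdd
  -- Deterministic rules along which all derivatives of order at most two converge uniformly.
  choose r σ hrσ using fun n : ℕ =>
    MALE.exists_cubatureError_le hE₂ (Nat.one_div_pos_of_nat (α := ℝ) (n := n))
  have he : Tendsto (fun n : ℕ => 1 / ((n : ℝ) + 1)) atTop (𝓝 0) :=
    tendsto_one_div_add_atTop_nhds_zero_nat
  have he0 : ∀ n : ℕ, 0 ≤ 1 / ((n : ℝ) + 1) := fun n => by positivity
  have hV : ∀ n j, (U (σ n) (r n)).node j ∈ Ω := fun n j => hU _ _ _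
  have hfam : MALE.RegularFamily ν Θ (MALE.likelihood Ω ω φ)
      (fun k => MALE.derivIntegral Ω ω φ (Fin.cons k Fin.elim0 : Fin 1 → Fin p))
      (fun l k => MALE.derivIntegral Ω ω φ
        (Fin.cons l (Fin.cons k Fin.elim0 : Fin 1 → Fin p) : Fin 2 → Fin p)) δ M :=
    { isCompact := hΘ
      pos := hδ
      lt := hf_lt
      measurable := hf_meas
      lintegral := hf_density
      bound := hM 0 (by norm_num) Fin.elim0
      bound₁ := fun k => hM 1 (by norm_num) _
      bound₂ := fun l k => hM 2 le_rfl _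
      cont := MALE.continuousOn_derivIntegral hφ hV he he0 hrσ (m := 0) (by norm_num) Fin.elim0
      cont₁ := fun k => MALE.continuousOn_derivIntegral hφ hV he he0 hrσ (by norm_num) _
      cont₂ := fun l k => MALE.continuousOn_derivIntegral hφ hV he he0 hrσ le_rfl _
      deriv := fun z θ hθ => MALE.hasFDerivAt_derivIntegral hφ hV he he0 hrσ (m := 0)
        (by norm_num) Fin.elim0 z hθ
      deriv₁ := fun k z θ hθ => MALE.hasFDerivAt_derivIntegral hφ hV he he0 hrσ (m := 1)
        (by norm_num) _ z hθ }
  refine hfam.asymptotic_normality (a := fun n s => MALE.approxLikelihood φ (U s (R n)))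
    (a₁ := fun n s k => MALE.derivApprox φ (U s (R n)) (Fin.cons k Fin.elim0 : Fin 1 → Fin p))
    hθ₀ hf_ident h_fisher hz_meas hz_indep hz_law ?_ ?_ hθhat_meas (MALE.eventually_whp_of_ae hθhat)
  · exact fun n s z θ hθ => MALE.hasFDerivAt_derivApprox (m := 0) (by norm_num) Fin.elim0
      fun j => hφ _ (hU s _ j) z θ (interior_subset hθ)
  · intro ε hε
    filter_upwards [hE₁.eventually_lt (ENNReal.ofReal_pos.2 hε),
      MALE.eventually_whp_of_eventually (eventually_ge_atTop 1)] with x hx hx1 z θ hθ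
    have h1 := MALE.le_ofReal_div_sqrt hx1 hx.le
    have h2 : 0 ≤ ε / Real.sqrt x.1 := by positivity
    exact ⟨MALE.abs_derivIntegral_sub_le h2 h1 (m := 0) (by norm_num) Fin.elim0 z hθ,
      fun k => MALE.abs_derivIntegral_sub_le h2 h1 le_rfl _ z hθ⟩
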